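/- Conventions. For a connected open set $D\subset\mathbb C^n$, $z,x,y,o\in D$ and $X\in\mathbb C^n$ let $$\kappa_D(z;X)=\inf\{|\alpha|:\ \alpha\in\mathbb C,\ \exists\,\varphi:\mathbb D\to D \text{ holomorphic},\ \varphi(0)=z,\ \alpha\varphi'(0)=X\},\qquad k_D(x,y)=\inf_\gamma\int_0^1\kappa_D(\gamma(t);\gamma'(t))\,dt,$$ the infimum being over all piecewise $\mathcal C^1$ curves $\gamma:[0,1]\to D$ from $x$ to $y$, and let $(x|y)_o=\tfrac12\,[k_D(x,o)+k_D(o,y)-k_D(x,y)]$. A geodesic is a curve $\sigma:[0,L]\to D$ with $k_D(\sigma(s),\sigma(t))=|s-t|$ for all $s,t\in[0,L]$. The domain $D$ has the visibility property if for all $p\ne q$ in $\partial D$ there are neighborhoods $U$ of $p$ and $V$ of $q$ with $\overline U\cap\overline V=\emptyset$ and a compact set $K\subset D$ such that every geodesic $\sigma:[0,L]\to D$ with $\sigma(0)\in U$, $\sigma(L)\in V$ meets $K$. Statement. Let $\psi,\chi_1,\chi_2:\mathbb R\to[0,\infty)$ be $\mathcal C^\infty$ even functions, strictly increasing on $[0,\infty)$,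 with $\psi(0)=\chi_1(0)=\chi_2(0)=0$. Let $\Omega_\psi\subset\mathbb C^2$ be a convex domain with $\mathcal C^\infty$ boundary, contained in the ball $B(0,5)$, such that $$\Omega_\psi\cap\{\|z\|<3\}=\{z\in\mathbb C^2:\ \|z\|<3,\ \operatorname{Re} z_2>\psi(\operatorname{Re} z_1)+\chi_1\big((|\operatorname{Im} z_1|-2)_+\big)+\chi_2(\operatorname{Im} z_2)\}.$$ Let $p=(i,0)$ and $q=(-i,0)$. If $\psi(x)=o\big(\exp(-\tfrac{\pi}{2x})\big)$ as $x\to0^+$, then for every base point $o\in\Omega_\psi$ $$\limsup_{\Omega_\psi\times\Omega_\psi\ni(p',q')\to(p,q)}(p'|q')_o=\infty,$$ and $\Omega_\psi$ does not have the visibility property. -/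

import Mathlib

open Set Filter Topology MeasureTheory
open scoped ENNReal ContDiff

noncomputable section

/-- The Kobayashi–Royden pseudometric
`κ_D(z; X) = inf {|α| : ∃ φ ∈ 𝒪(𝔻, D), φ(0) = z, α φ'(0) = X}`. -/
def kobayashiRoyden {n : ℕ} (D : Set (EuclideanSpace ℂ (Fin n)))
    (z X : EuclideanSpace ℂ (Fin n)) : ℝ :=
  sInf {r : ℝ | ∃ (α : ℂ) (φ : ℂ → EuclideanSpace ℂ (Fin n)),
    DifferentiableOn ℂ φ (Metric.ball 0 1) ∧ MapsTo φ (Metric.ball 0 1) D ∧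
    φ 0 = z ∧ α • deriv φ 0 = X ∧ r = ‖α‖}

/-- `γ` restricted to `[0,1]` is a piecewise `C¹` curve in `D` from `x` to `y`: it is continuous
and there is a partition `0 = t₀ ≤ t₁ ≤ ⋯ ≤ t_N = 1` such that `γ` is `C¹` on every closed
interval `[t_i, t_{i+1}]`. -/
def IsPiecewiseC1Curve {n : ℕ} (D : Set (EuclideanSpace ℂ (Fin n)))
    (x y : EuclideanSpace ℂ (Fin n)) (γ : ℝ → EuclideanSpace ℂ (Fin n)) : Prop :=
  ContinuousOn γ (Icc 0 1) ∧ MapsTo γ (Icc 0 1) D ∧ γ 0 = x ∧ γ 1 = y ∧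
    ∃ (N : ℕ) (t : ℕ → ℝ), Monotone t ∧ t 0 = 0 ∧ t N = 1 ∧
      ∀ i < N, ContDiffOn ℝ 1 γ (Icc (t i) (t (i + 1)))

/-- The infimum of the Kobayashi–Royden lengths of the piecewise `C¹` curves in `D` from `x`
to `y`, as an extended nonnegative number (`∞` if there is no such curve). -/
def kobayashiEDist {n : ℕ} (D : Set (EuclideanSpace ℂ (Fin n)))
    (x y : EuclideanSpace ℂ (Fin n)) : ℝ≥0∞ :=
  ⨅ (γ : ℝ → EuclideanSpace ℂ (Fin n)) (_ : IsPiecewiseC1Curve D x y γ),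
    ∫⁻ t in Icc (0 : ℝ) 1, ENNReal.ofReal (kobayashiRoyden D (γ t) (deriv γ t))

/-- The Kobayashi pseudodistance `k_D(x, y)`, for points of a connected open set `D`
(for which the infimum above is finite). -/
def kobayashiDist {n : ℕ} (D : Set (EuclideanSpace ℂ (Fin n)))
    (x y : EuclideanSpace ℂ (Fin n)) : ℝ :=
  (kobayashiEDist D x y).toReal

/-- The Gromov product `(x|y)_o` for the Kobayashi distance of `D`. -/
def gromovProduct {n : ℕ} (D : Set (EuclideanSpace ℂ (Fin n)))
    (o x y : EuclideanSpace ℂ (Fin n)) : ℝ :=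
  (kobayashiDist D x o + kobayashiDist D o y - kobayashiDist D x y) / 2

/-- `σ` restricted to `[0, L]` is a geodesic of `D` for the Kobayashi distance. -/
def IsKobayashiGeodesic {n : ℕ} (D : Set (EuclideanSpace ℂ (Fin n)))
    (L : ℝ) (σ : ℝ → EuclideanSpace ℂ (Fin n)) : Prop :=
  ContinuousOn σ (Icc 0 L) ∧ MapsTo σ (Icc 0 L) D ∧
    ∀ s ∈ Icc (0 : ℝ) L, ∀ t ∈ Icc (0 : ℝ) L, kobayashiDist D (σ s) (σ t) = |s - t|

/-- The pair `{p, q}` of boundary points has visible geodesics. -/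
def HasVisibleGeodesics {n : ℕ} (D : Set (EuclideanSpace ℂ (Fin n)))
    (p q : EuclideanSpace ℂ (Fin n)) : Prop :=
  ∃ U ∈ 𝓝 p, ∃ V ∈ 𝓝 q, Disjoint (closure U) (closure V) ∧
    ∃ K : Set (EuclideanSpace ℂ (Fin n)), IsCompact K ∧ K ⊆ D ∧
      ∀ (L : ℝ) (σ : ℝ → EuclideanSpace ℂ (Fin n)), 0 ≤ L → IsKobayashiGeodesic D L σ →
        σ 0 ∈ U → σ L ∈ V → (σ '' Icc 0 L ∩ K).Nonempty

/-- The visibility property: every pair of distinct boundary points has visible geodesics. -/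
def HasVisibilityProperty {n : ℕ} (D : Set (EuclideanSpace ℂ (Fin n))) : Prop :=
  ∀ p ∈ frontier D, ∀ q ∈ frontier D, p ≠ q → HasVisibleGeodesics D p q

/-- `D` has `C^∞` boundary: near each boundary point, `D` is the sublevel set `{ρ < 0}` of a
smooth real function with nonvanishing differential at that point. -/
def HasSmoothBoundary {n : ℕ} (D : Set (EuclideanSpace ℂ (Fin n))) : Prop :=
  ∀ x ∈ frontier D, ∃ (U : Set (EuclideanSpace ℂ (Fin n))) (ρ : EuclideanSpace ℂ (Fin n) → ℝ),
    IsOpen U ∧ x ∈ U ∧ ContDiffOn ℝ ∞ ρ U ∧ fderiv ℝ ρ x ≠ 0 ∧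
      D ∩ U = {z | z ∈ U ∧ ρ z < 0}

/-- Smooth, even, nonnegative functions on `ℝ` that vanish at `0` and are strictly increasing
on `[0, ∞)`. -/
structure IsProfile (f : ℝ → ℝ) : Prop where
  contDiff : ContDiff ℝ ∞ f
  even : ∀ x, f (-x) = f x
  nonneg : ∀ x, 0 ≤ f x
  map_zero : f 0 = 0
  strictMonoOn : StrictMonoOn f (Ici 0)

/-- `Ω` is a smoothly bounded convex domain in `ℂ²`, contained in the ball `B(0,5)`, which inside
the ball `B(0,3)` is given by
`Re z₂ > ψ(Re z₁) + χ₁((|Im z₁| - 2)₊) + χ₂(Im z₂)`. The coordinates `z₁, z₂` are `z 0, z 1`. -/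
structure IsModelDomain (ψ χ₁ χ₂ : ℝ → ℝ) (Ω : Set (EuclideanSpace ℂ (Fin 2))) : Prop where
  isOpen : IsOpen Ω
  convex : Convex ℝ Ω
  smoothBoundary : HasSmoothBoundary Ω
  subset_ball : Ω ⊆ Metric.ball 0 5
  inter_ball : Ω ∩ {z | ‖z‖ < 3} =
    {z | ‖z‖ < 3 ∧ (z 1).re > ψ (z 0).re + χ₁ (max (|(z 0).im| - 2) 0) + χ₂ (z 1).im}

end

/-! Let P = (i, ψ(x)) and Q = (-i, ψ(x)), which tend to p and q as x → 0⁺. Two estimates are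
compared. From above: the slice z₂ = ψ(x) of Ω contains the rectangle |Re z₁| < x, |Im z₁| ≤ 2. The
straight path from P to Q costs little more than in the strip |Re z₁| < x, whose metric on the axis
is π/(4x), so k(P, Q) ≤ π/(2x) + 2 (`kobayashiDist_vertical_le`). From below: by convexity Ω lies in
Re z₂ > 0, and Schwarz–Pick bounds the distance of P or Q to a point z below by ½ log(Re z₂ / ψ(x))
(`log_div_le`). The distances from P and Q to a fixed point thus add up to at least -log ψ(x) -
O(1). The hypothesis on ψ says that -log ψ(x) - π/(2x) → ∞, so the Gromov product blows up. If a
geodesic from P to Q met a compact K, the two lower bounds, uniform on K, would add up to at most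
k(P, Q), which is impossible for small x. This needs geodesics from P to Q
(`exists_isKobayashiGeodesic`): closed Kobayashi balls of a bounded convex domain are compact, and a
geodesic is extracted by Tychonoff. -/

/-! ### The Kobayashi–Royden metric: bounds from inscribed balls and from half-planes. -/

section KobayashiRoyden

variable {n : ℕ} {D : Set (EuclideanSpace ℂ (Fin n))} {z X : EuclideanSpace ℂ (Fin n)}

theorem kobayashiRoyden_nonneg : 0 ≤ kobayashiRoyden D z X :=
  Real.sInf_nonneg (by rintro r ⟨α, φ, -, -, -, -, rfl⟩; exact norm_nonneg α)

theorem kobayashiRoyden_le {α : ℂ} {φ : ℂ → EuclideanSpace ℂ (Fin n)}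
    (hd : DifferentiableOn ℂ φ (Metric.ball 0 1)) (hm : MapsTo φ (Metric.ball 0 1) D)
    (h0 : φ 0 = z) (hX : α • deriv φ 0 = X) : kobayashiRoyden D z X ≤ ‖α‖ :=
  csInf_le ⟨0, by rintro r ⟨α, φ, -, -, -, -, rfl⟩; exact norm_nonneg α⟩
    ⟨α, φ, hd, hm, h0, hX, rfl⟩

theorem exists_disc_of_ball_subset {r : ℝ} (hr : 0 < r) (hD : Metric.ball z r ⊆ D) :
    ∃ (α : ℂ) (φ : ℂ → EuclideanSpace ℂ (Fin n)), DifferentiableOn ℂ φ (Metric.ball 0 1) ∧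
      MapsTo φ (Metric.ball 0 1) D ∧ φ 0 = z ∧ α • deriv φ 0 = X ∧ ‖α‖ = ‖X‖ / r := by
  rcases eq_or_ne X 0 with rfl | hX
  · exact ⟨0, fun _ => z, by fun_prop, fun _ _ => hD (Metric.mem_ball_self hr), rfl, by simp,
      by simp⟩
  have hX' : (‖X‖ : ℂ) ≠ 0 := by simpa using hX
  have hr' : (r : ℂ) ≠ 0 := by exact_mod_cast hr.ne'
  have hderiv : HasDerivAt (fun ζ : ℂ => z + ζ • (((r / ‖X‖ : ℝ) : ℂ) • X))
      (((r / ‖X‖ : ℝ) : ℂ) • X) 0 := by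
    simpa using ((hasDerivAt_id (0 : ℂ)).smul_const (((r / ‖X‖ : ℝ) : ℂ) • X)).const_add z
  refine ⟨((‖X‖ / r : ℝ) : ℂ), fun ζ => z + ζ • (((r / ‖X‖ : ℝ) : ℂ) • X), by fun_prop, ?_,
    by simp, ?_, ?_⟩
  · intro ζ hζ
    apply hD
    rw [mem_ball_zero_iff] at hζ
    rw [mem_ball_iff_norm, add_sub_cancel_left, norm_smul, norm_smul, Complex.norm_real,
      Real.norm_of_nonneg (by positivity), div_mul_cancel₀ _ (norm_ne_zero_iff.2 hX)]
    nlinarith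
  · rw [hderiv.deriv, smul_smul]
    push_cast
    rw [div_mul_div_cancel₀ hr', div_self hX', one_smul]
  · rw [Complex.norm_real, Real.norm_of_nonneg (by positivity)]

theorem kobayashiRoyden_le_of_ball_subset {r : ℝ} (hr : 0 < r) (hD : Metric.ball z r ⊆ D) :
    kobayashiRoyden D z X ≤ ‖X‖ / r := by
  obtain ⟨α, φ, hd, hm, h0, hX, hα⟩ := exists_disc_of_ball_subset (X := X) hr hD
  exact (kobayashiRoyden_le hd hm h0 hX).trans_eq hα

/-- Openness and `z ∈ D` supply an affine disc, so the infimum is over a nonempty set; `sInf ∅ = 0`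
would break the bound. -/
theorem le_kobayashiRoyden (hD : IsOpen D) (hz : z ∈ D) {c : ℝ}
    (h : ∀ (α : ℂ) (φ : ℂ → EuclideanSpace ℂ (Fin n)), DifferentiableOn ℂ φ (Metric.ball 0 1) →
      MapsTo φ (Metric.ball 0 1) D → φ 0 = z → α • deriv φ 0 = X → c ≤ ‖α‖) :
    c ≤ kobayashiRoyden D z X := by
  obtain ⟨r, hr, hrD⟩ := Metric.isOpen_iff.1 hD z hz
  obtain ⟨α, φ, hd, hm, h0, hX, hα⟩ := exists_disc_of_ball_subset (X := X) hr hrD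
  refine le_csInf ⟨_, α, φ, hd, hm, h0, hX, rfl⟩ ?_
  rintro _ ⟨α, φ, hd, hm, h0, hX, rfl⟩
  exact h α φ hd hm h0 hX

theorem kobayashiRoyden_smul_le (hD : IsOpen D) (hz : z ∈ D) (c : ℝ) (hc : c ≠ 0) :
    kobayashiRoyden D z (c • X) ≤ |c| * kobayashiRoyden D z X := by
  have hc' : 0 < |c| := abs_pos.2 hc
  rw [← div_le_iff₀' hc']
  refine le_kobayashiRoyden hD hz fun α φ hd hm h0 hX => ?_
  rw [div_le_iff₀' hc']
  refine (kobayashiRoyden_le (α := c * α) hd hm h0 ?_).trans_eq ?_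
  · rw [mul_smul, hX, Complex.coe_smul]
  · simp

theorem kobayashiRoyden_smul (hD : IsOpen D) (hz : z ∈ D) (c : ℝ) (hc : c ≠ 0) :
    kobayashiRoyden D z (c • X) = |c| * kobayashiRoyden D z X := by
  refine le_antisymm (kobayashiRoyden_smul_le hD hz c hc) ?_
  have h := kobayashiRoyden_smul_le (X := c • X) hD hz c⁻¹ (inv_ne_zero hc)
  rw [inv_smul_smul₀ hc, abs_inv] at h
  rwa [← le_inv_mul_iff₀ (abs_pos.2 hc)]

/-- Discs centred at `z` stay within distance 2R of `z`, and the Cauchy–Schwarz-type derivative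
bound applies. This makes k dominate the Euclidean distance, hence separate points. -/
theorem norm_le_mul_kobayashiRoyden (hD : IsOpen D) (hz : z ∈ D) {R : ℝ} (hR : 0 < R)
    (hDR : D ⊆ Metric.ball 0 R) : ‖X‖ ≤ 2 * R * kobayashiRoyden D z X := by
  rw [← div_le_iff₀' (by positivity)]
  refine le_kobayashiRoyden hD hz fun α φ hd hm h0 hX => ?_
  have h : ‖deriv φ 0‖ ≤ 2 * R / 1 := by
    refine Complex.norm_deriv_le_div_of_mapsTo_ball hd (fun ζ hζ => ?_) one_pos
    have h1 := mem_ball_zero_iff.1 (hDR (hm hζ))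
    have h2 := mem_ball_zero_iff.1 (hDR hz)
    rw [mem_closedBall_iff_norm, h0]
    linarith [norm_sub_le (φ ζ) z]
  rw [div_le_iff₀' (by positivity), ← hX, norm_smul]
  nlinarith [norm_nonneg α]

/-- The Schwarz–Pick estimate at the centre of the disc for maps into a half-plane. -/
theorem norm_deriv_le_of_mapsTo_halfPlane {f : ℂ → ℂ} {c : ℝ}
    (hd : DifferentiableOn ℂ f (Metric.ball 0 1))
    (hm : ∀ ζ ∈ Metric.ball (0 : ℂ) 1, (f ζ).re < c) :
    ‖deriv f 0‖ ≤ 2 * (c - (f 0).re) := by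
  have h0 : (0 : ℂ) ∈ Metric.ball (0 : ℂ) 1 := by simp
  -- The reflection of `f 0` in the line Re = c. The Cayley transform (f - f 0)/(w - f) maps into
  -- the unit disc and vanishes at 0.
  set w : ℂ := 2 * c - (starRingEnd ℂ) (f 0) with hw
  have hne : ∀ ζ ∈ Metric.ball (0 : ℂ) 1, w - f ζ ≠ 0 := by
    intro ζ hζ h
    have := congrArg Complex.re h
    simp [hw] at this
    linarith [hm ζ hζ, hm 0 h0]
  have hda : DifferentiableAt ℂ f 0 := hd.differentiableAt (Metric.ball_mem_nhds 0 one_pos)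
  have hpos : 0 < c - (f 0).re := by linarith [hm 0 h0]
  have hwf : w - f 0 = ((2 * (c - (f 0).re) : ℝ) : ℂ) := by
    apply Complex.ext <;> simp [hw]
    ring
  have hg : HasDerivAt (fun ζ => (f ζ - f 0) / (w - f ζ)) (deriv f 0 / (w - f 0)) 0 := by
    have := (hda.hasDerivAt.sub_const (f 0)).div (hda.hasDerivAt.const_sub w) (hne 0 h0)
    refine this.congr_deriv ?_
    have := hne 0 h0
    field_simp
    ring
  have key := Complex.norm_deriv_le_one_of_mapsTo_ball (c := 0) (R := 1)
    (f := fun ζ => (f ζ - f 0) / (w - f ζ))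
    ((hd.sub_const _).div (hd.const_sub w) hne) (fun ζ hζ => ?_) one_pos
  · rw [hg.deriv, hwf, norm_div, Complex.norm_real, Real.norm_of_nonneg (by linarith),
      div_le_one (by linarith)] at key
    exact key
  · rw [sub_self, zero_div, mem_closedBall_zero_iff, norm_div, div_le_one
      (norm_pos_iff.2 (hne ζ hζ)), ← sq_le_sq₀ (norm_nonneg _) (norm_nonneg _),
      Complex.sq_norm, Complex.sq_norm, Complex.normSq_apply, Complex.normSq_apply]
    simp only [hw, Complex.sub_re, Complex.sub_im, Complex.mul_re, Complex.mul_im,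
      Complex.ofReal_re, Complex.ofReal_im, Complex.conj_re, Complex.conj_im, Complex.re_ofNat,
      Complex.im_ofNat]
    nlinarith [mul_pos (sub_pos.2 (hm ζ hζ)) hpos]

theorem norm_apply_le_mul_kobayashiRoyden (hD : IsOpen D) (hz : z ∈ D)
    (f : EuclideanSpace ℂ (Fin n) →L[ℂ] ℂ) {c : ℝ} (hf : ∀ w ∈ D, (f w).re < c) :
    ‖f X‖ ≤ 2 * (c - (f z).re) * kobayashiRoyden D z X := by
  have hpos : 0 < 2 * (c - (f z).re) := by linarith [hf z hz]
  rw [← div_le_iff₀' hpos]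
  refine le_kobayashiRoyden hD hz fun α φ hd hm h0 hX => ?_
  have h := norm_deriv_le_of_mapsTo_halfPlane (f := fun ζ => f (φ ζ)) (c := c)
    (f.differentiable.comp_differentiableOn hd) fun ζ hζ => hf _ (hm hζ)
  have hda : DifferentiableAt ℂ φ 0 := hd.differentiableAt (Metric.ball_mem_nhds 0 one_pos)
  have hder : deriv (fun ζ => f (φ ζ)) 0 = f (deriv φ 0) :=
    (f.hasFDerivAt.comp_hasDerivAt 0 hda.hasDerivAt).deriv
  rw [hder, h0] at h
  rw [div_le_iff₀' hpos, ← hX, map_smul, norm_smul]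
  nlinarith [norm_nonneg α]

end KobayashiRoyden

/-! ### Piecewise C¹ curves, their lengths, and the extended distance. -/

section Curves

/-- `γ` is piecewise `C¹` on `[a, b]`. -/
inductive PiecewiseC1 {E : Type*} [NormedAddCommGroup E] [NormedSpace ℝ E] (γ : ℝ → E)
    (a : ℝ) : ℝ → Prop
  | refl : PiecewiseC1 γ a a
  | snoc {b c : ℝ} : PiecewiseC1 γ a b → b ≤ c → ContDiffOn ℝ 1 γ (Icc b c) →
      PiecewiseC1 γ a c

namespace PiecewiseC1

variable {E : Type*} [NormedAddCommGroup E] [NormedSpace ℝ E] {γ γ' : ℝ → E} {a b c : ℝ}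

theorem le (h : PiecewiseC1 γ a b) : a ≤ b := by
  induction h with
  | refl => exact le_rfl
  | snoc _ hbc _ ih => exact ih.trans hbc

theorem of_contDiffOn (hab : a ≤ b) (h : ContDiffOn ℝ 1 γ (Icc a b)) : PiecewiseC1 γ a b :=
  snoc refl hab h

theorem trans (h₁ : PiecewiseC1 γ a b) (h₂ : PiecewiseC1 γ b c) : PiecewiseC1 γ a c := by
  induction h₂ with
  | refl => exact h₁
  | snoc _ hbc hd ih => exact snoc ih hbc hd

theorem continuousOn (h : PiecewiseC1 γ a b) : ContinuousOn γ (Icc a b) := by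
  induction h with
  | refl => simp
  | snoc h hbc hd ih =>
    rw [← Icc_union_Icc_eq_Icc h.le hbc]
    exact ih.union_of_isClosed hd.continuousOn isClosed_Icc isClosed_Icc

theorem split (h : PiecewiseC1 γ a b) {s : ℝ} (hs : s ∈ Icc a b) :
    PiecewiseC1 γ a s ∧ PiecewiseC1 γ s b := by
  induction h with
  | refl =>
    obtain rfl : s = a := le_antisymm hs.2 hs.1
    exact ⟨refl, refl⟩
  | @snoc b c h hbc hd ih =>
    rcases le_total s b with hsb | hsb
    · exact ⟨(ih ⟨hs.1, hsb⟩).1, snoc (ih ⟨hs.1, hsb⟩).2 hbc hd⟩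
    · exact ⟨snoc h hsb (hd.mono (Icc_subset_Icc le_rfl hs.2)),
        of_contDiffOn hs.2 (hd.mono (Icc_subset_Icc hsb le_rfl))⟩

theorem congr (h : PiecewiseC1 γ a b) (hγ : EqOn γ' γ (Icc a b)) : PiecewiseC1 γ' a b := by
  induction h with
  | refl => exact refl
  | snoc h hbc hd ih =>
    exact snoc (ih (hγ.mono (Icc_subset_Icc le_rfl hbc))) hbc
      (hd.congr (hγ.mono (Icc_subset_Icc h.le le_rfl)))

theorem comp_affine (h : PiecewiseC1 γ a b) {m : ℝ} (hm : 0 < m) (d : ℝ) :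
    PiecewiseC1 (fun t => γ (m * t + d)) ((a - d) / m) ((b - d) / m) := by
  induction h with
  | refl => exact refl
  | @snoc b c h hbc hd ih =>
    refine snoc ih (by gcongr) (hd.comp (t := Icc b c) (by fun_prop) fun t ht => ?_)
    rw [mem_Icc, div_le_iff₀' hm, le_div_iff₀' hm] at ht
    constructor <;> linarith [ht.1, ht.2]

theorem comp_neg (h : PiecewiseC1 γ a b) : PiecewiseC1 (fun t => γ (-t)) (-b) (-a) := by
  induction h with
  | refl => exact refl
  | @snoc b c h hbc hd ih =>
    refine (of_contDiffOn (by linarith) (hd.comp (t := Icc b c) (by fun_prop) fun t ht => ?_)).trans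
      ih
    constructor <;> linarith [ht.1, ht.2]

theorem exists_partition (h : PiecewiseC1 γ a b) :
    ∃ (N : ℕ) (t : ℕ → ℝ), Monotone t ∧ t 0 = a ∧ t N = b ∧
      ∀ i < N, ContDiffOn ℝ 1 γ (Icc (t i) (t (i + 1))) := by
  induction h with
  | refl => exact ⟨0, fun _ => a, monotone_const, rfl, rfl, by simp⟩
  | @snoc b c h hbc hd ih =>
    obtain ⟨N, t, ht, h0, hN, hi⟩ := ih
    refine ⟨N + 1, fun i => if i ≤ N then t i else c, ?_, by simp [h0], by simp, ?_⟩
    · intro i j hij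
      dsimp only
      split_ifs with h1 h2
      · exact ht hij
      · exact (ht h1).trans (hN.trans_le hbc)
      · omega
      · exact le_rfl
    · intro i hiN
      rcases eq_or_lt_of_le (Nat.lt_succ_iff.1 hiN) with rfl | hlt
      · simpa [hN] using hd
      · have h1 : i ≤ N := hlt.le
        have h2 : i + 1 ≤ N := hlt
        simpa [h1, h2] using hi i hlt

theorem of_partition {N : ℕ} {t : ℕ → ℝ} (ht : Monotone t)
    (hi : ∀ i < N, ContDiffOn ℝ 1 γ (Icc (t i) (t (i + 1)))) : PiecewiseC1 γ (t 0) (t N) := by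
  induction N with
  | zero => exact refl
  | succ N ih =>
    exact snoc (ih fun i h => hi i (h.trans N.lt_succ_self)) (ht N.le_succ) (hi N N.lt_succ_self)

end PiecewiseC1

variable {n : ℕ} {D : Set (EuclideanSpace ℂ (Fin n))} {x y : EuclideanSpace ℂ (Fin n)}
  {γ γ' : ℝ → EuclideanSpace ℂ (Fin n)} {a b c : ℝ}

theorem isPiecewiseC1Curve_iff : IsPiecewiseC1Curve D x y γ ↔
    PiecewiseC1 γ 0 1 ∧ MapsTo γ (Icc 0 1) D ∧ γ 0 = x ∧ γ 1 = y := by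
  constructor
  · rintro ⟨-, hm, h0, h1, N, t, ht, ht0, htN, hi⟩
    exact ⟨ht0 ▸ htN ▸ PiecewiseC1.of_partition ht hi, hm, h0, h1⟩
  · rintro ⟨h, hm, h0, h1⟩
    exact ⟨h.continuousOn, hm, h0, h1, h.exists_partition⟩

/-- The Kobayashi–Royden length of `γ` on `[a, b]`. -/
noncomputable def kobayashiLength (D : Set (EuclideanSpace ℂ (Fin n)))
    (γ : ℝ → EuclideanSpace ℂ (Fin n)) (a b : ℝ) : ℝ≥0∞ :=
  ∫⁻ t in Ioo a b, ENNReal.ofReal (kobayashiRoyden D (γ t) (deriv γ t))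

/-- On an open interval, equality of curves gives equality of derivatives; the endpoints are null.
Lengths take values in `ℝ≥0∞`, so measurability of κ along curves never has to be checked. -/
theorem kobayashiLength_congr (h : EqOn γ γ' (Ioo a b)) :
    kobayashiLength D γ a b = kobayashiLength D γ' a b := by
  refine setLIntegral_congr_fun measurableSet_Ioo fun t ht => ?_
  have h' : γ =ᶠ[𝓝 t] γ' := h.eventuallyEq_of_mem (isOpen_Ioo.mem_nhds ht)
  simp only [h ht, h'.deriv_eq]

theorem kobayashiLength_add (hab : a ≤ b) (hbc : b ≤ c) :
    kobayashiLength D γ a b + kobayashiLength D γ b c = kobayashiLength D γ a c := by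
  simp only [kobayashiLength, restrict_Ioo_eq_restrict_Ioc]
  rw [← Ioc_union_Ioc_eq_Ioc hab hbc,
    lintegral_union measurableSet_Ioc (Ioc_disjoint_Ioc_of_le le_rfl)]

/-- Stating the domain through its image allows m < 0, which reversal of curves requires. -/
theorem kobayashiLength_comp_affine (hD : IsOpen D) (hγ : MapsTo γ (Ioo a b) D) {m : ℝ}
    (hm : m ≠ 0) (d : ℝ) {s : Set ℝ} (hs : MeasurableSet s)
    (himg : (fun t => m * t + d) '' s = Ioo a b) :
    ∫⁻ t in s, ENNReal.ofReal (kobayashiRoyden D (γ (m * t + d))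
      (deriv (fun t => γ (m * t + d)) t)) = kobayashiLength D γ a b := by
  rw [kobayashiLength, ← himg, lintegral_image_eq_lintegral_abs_deriv_mul hs (f' := fun _ => m)
    (fun t _ => by simpa using (((hasDerivAt_id t).const_mul m).add_const d).hasDerivWithinAt)
    (fun t _ t' _ h => by simpa [hm] using h)]
  refine setLIntegral_congr_fun hs fun t ht => ?_
  have hmem : m * t + d ∈ Ioo a b := himg ▸ mem_image_of_mem (fun t => m * t + d) ht
  have hder : deriv (fun t => γ (m * t + d)) t = m • deriv γ (m * t + d) := by
    rw [deriv_comp_mul_left m (fun u => γ (u + d)) t, deriv_comp_add_const]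
  rw [hder, kobayashiRoyden_smul hD (hγ hmem) m hm, ENNReal.ofReal_mul (abs_nonneg m)]

theorem kobayashiEDist_le_of_curve (h : PiecewiseC1 γ 0 1) (hγ : MapsTo γ (Icc 0 1) D) :
    kobayashiEDist D (γ 0) (γ 1) ≤ kobayashiLength D γ 0 1 := by
  refine (iInf₂_le γ (isPiecewiseC1Curve_iff.2 ⟨h, hγ, rfl, rfl⟩)).trans_eq ?_
  rw [kobayashiLength, restrict_Ioo_eq_restrict_Icc]

theorem exists_curve_of_kobayashiEDist_lt {r : ℝ≥0∞} (h : kobayashiEDist D x y < r) :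
    ∃ γ : ℝ → EuclideanSpace ℂ (Fin n), PiecewiseC1 γ 0 1 ∧ MapsTo γ (Icc 0 1) D ∧ γ 0 = x ∧
      γ 1 = y ∧ kobayashiLength D γ 0 1 < r := by
  simp only [kobayashiEDist, iInf_lt_iff] at h
  obtain ⟨γ, hγ, hlt⟩ := h
  obtain ⟨h1, h2, h3, h4⟩ := isPiecewiseC1Curve_iff.1 hγ
  exact ⟨γ, h1, h2, h3, h4, by rwa [kobayashiLength, restrict_Ioo_eq_restrict_Icc]⟩

theorem kobayashiEDist_self (hx : x ∈ D) : kobayashiEDist D x x = 0 := by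
  obtain h := kobayashiEDist_le_of_curve (D := D) (γ := fun _ => x)
    (PiecewiseC1.of_contDiffOn zero_le_one contDiffOn_const) (fun _ _ => hx)
  refine le_antisymm (h.trans_eq ?_) zero_le
  have h0 : kobayashiRoyden D x 0 = 0 := by
    refine le_antisymm ?_ kobayashiRoyden_nonneg
    simpa using kobayashiRoyden_le (D := D) (α := 0) (φ := fun _ => x) (by fun_prop)
      (fun _ _ => hx) rfl (by simp)
  simp [kobayashiLength, h0]

theorem kobayashiEDist_le_kobayashiLength (hD : IsOpen D) (h : PiecewiseC1 γ a b)
    (hγ : MapsTo γ (Icc a b) D) :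
    kobayashiEDist D (γ a) (γ b) ≤ kobayashiLength D γ a b := by
  rcases h.le.eq_or_lt with rfl | hab
  · rw [kobayashiEDist_self (hγ (by simp))]
    exact zero_le
  have hm : 0 < b - a := sub_pos.2 hab
  have himg : (fun t => (b - a) * t + a) '' Ioo 0 1 = Ioo a b := by
    rw [image_affine_Ioo hm]
    simp
  have h1 := h.comp_affine hm a
  rw [sub_self, zero_div, div_self hm.ne'] at h1
  have h2 := kobayashiEDist_le_of_curve (D := D) h1 fun t ht => hγ ⟨by nlinarith [ht.1],
    by nlinarith [ht.2]⟩
  simp only [mul_zero, zero_add, mul_one, sub_add_cancel] at h2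
  exact h2.trans_eq (kobayashiLength_comp_affine hD (hγ.mono_left Ioo_subset_Icc_self) hm.ne' a
    measurableSet_Ioo himg)

theorem kobayashiEDist_triangle (hD : IsOpen D) (x y z : EuclideanSpace ℂ (Fin n)) :
    kobayashiEDist D x z ≤ kobayashiEDist D x y + kobayashiEDist D y z := by
  refine ENNReal.le_of_forall_pos_le_add fun ε hε hlt => ?_
  have hε' : (ε / 2 : ℝ≥0∞) ≠ 0 := by simpa using hε.ne'
  rw [ENNReal.add_lt_top] at hlt
  obtain ⟨γ₁, h₁, hm₁, h₁0, h₁1, hl₁⟩ :=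
    exists_curve_of_kobayashiEDist_lt (ENNReal.lt_add_right hlt.1.ne hε')
  obtain ⟨γ₂, h₂, hm₂, h₂0, h₂1, hl₂⟩ :=
    exists_curve_of_kobayashiEDist_lt (ENNReal.lt_add_right hlt.2.ne hε')
  -- Concatenation on [0, 2]; the form `1 * t + (-1)` is the shift as an affine reparametrization.
  -- Passing back to [0, 1] is done by `kobayashiEDist_le_kobayashiLength`.
  set γ : ℝ → EuclideanSpace ℂ (Fin n) := fun t => if t ≤ 1 then γ₁ t else γ₂ (1 * t + (-1))
    with hγ
  have e₁ : EqOn γ γ₁ (Icc 0 1) := fun t ht => if_pos ht.2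
  have e₂ : EqOn γ (fun t => γ₂ (1 * t + (-1))) (Icc 1 2) := by
    intro t ht
    rcases ht.1.eq_or_lt with rfl | hlt
    · simp [hγ, h₁1, h₂0]
    · simp [hγ, not_le.2 hlt]
  have p₂ := h₂.comp_affine one_pos (-1)
  norm_num only at p₂
  have himg : (fun t : ℝ => 1 * t + (-1)) '' Ioo 1 2 = Ioo 0 1 := by
    rw [image_affine_Ioo one_pos]
    norm_num
  have hm₂' : MapsTo (fun t => γ₂ (1 * t + (-1))) (Icc 1 2) D :=
    fun t ht => hm₂ ⟨by linarith [ht.1], by linarith [ht.2]⟩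
  have p : PiecewiseC1 γ 0 2 := (h₁.congr e₁).trans
    (p₂.congr (by simpa [sub_eq_add_neg] using e₂))
  have hm : MapsTo γ (Icc 0 2) D := by
    intro t ht
    rcases le_total t 1 with h | h
    · rw [e₁ ⟨ht.1, h⟩]; exact hm₁ ⟨ht.1, h⟩
    · rw [e₂ ⟨h, ht.2⟩]; exact hm₂' ⟨h, ht.2⟩
  have key := kobayashiEDist_le_kobayashiLength hD p hm
  have l₂ := kobayashiLength_comp_affine (D := D) hD (hm₂.mono_left Ioo_subset_Icc_self) one_ne_zero
    (-1) measurableSet_Ioo himg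
  rw [← kobayashiLength_add zero_le_one one_le_two,
    kobayashiLength_congr (e₁.mono Ioo_subset_Icc_self),
    kobayashiLength_congr (e₂.mono Ioo_subset_Icc_self)] at key
  have hγ0 : γ 0 = x := by rw [e₁ (by simp), h₁0]
  have hγ2 : γ 2 = z := by
    rw [e₂ (by simp), ← h₂1]
    norm_num
  rw [hγ0, hγ2] at key
  refine key.trans ((add_le_add hl₁.le (l₂.trans_le hl₂.le)).trans_eq ?_)
  rw [add_add_add_comm, ENNReal.add_halves]

theorem kobayashiEDist_comm (hD : IsOpen D) (x y : EuclideanSpace ℂ (Fin n)) :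
    kobayashiEDist D x y = kobayashiEDist D y x := by
  suffices ∀ x y, kobayashiEDist D x y ≤ kobayashiEDist D y x from le_antisymm (this x y) (this y x)
  intro x y
  refine le_of_forall_gt fun r hr => ?_
  obtain ⟨γ, h, hm, h0, h1, hl⟩ := exists_curve_of_kobayashiEDist_lt hr
  have himg : (fun t : ℝ => -1 * t + 0) '' Ioo (-1) (-0) = Ioo 0 1 := by simp
  have l := kobayashiLength_comp_affine (D := D) hD (hm.mono_left Ioo_subset_Icc_self)
    (neg_ne_zero.2 one_ne_zero) 0 measurableSet_Ioo himg
  have key := kobayashiEDist_le_kobayashiLength hD h.comp_neg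
    (fun t ht => hm ⟨by linarith [ht.2], by linarith [ht.1]⟩)
  simp only [neg_neg, neg_zero, h0, h1] at key
  simp only [neg_mul, one_mul, add_zero, neg_zero] at l
  exact key.trans_lt (l.trans_lt hl)

end Curves

/-! ### The distance on convex domains: lower bounds, continuity, compact balls, intermediate
points. -/

section Distance

variable {n : ℕ} {D : Set (EuclideanSpace ℂ (Fin n))} {x y z : EuclideanSpace ℂ (Fin n)}
  {γ : ℝ → EuclideanSpace ℂ (Fin n)} {a b : ℝ}

/-- Contraction principle: a map whose differential is dominated by κ does not increase length. The
lower bounds for k below come from particular choices of `F`. -/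
theorem enorm_sub_le_kobayashiLength {G : Type*} [NormedAddCommGroup G] [NormedSpace ℝ G]
    (hD : IsOpen D) {F : EuclideanSpace ℂ (Fin n) → G} (hF : ContDiffOn ℝ 1 F D)
    (hF' : ∀ z ∈ D, ∀ X, ‖fderiv ℝ F z X‖ ≤ kobayashiRoyden D z X)
    (h : PiecewiseC1 γ a b) (hm : MapsTo γ (Icc a b) D) :
    ‖F (γ b) - F (γ a)‖ₑ ≤ kobayashiLength D γ a b := by
  induction h with
  | refl => simp
  | @snoc b c h hbc hd ih =>
    have hmc : MapsTo γ (Icc b c) D := hm.mono_left (Icc_subset_Icc h.le le_rfl)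
    have h1 := ih (hm.mono_left (Icc_subset_Icc le_rfl hbc))
    have h2 := enorm_sub_le_lintegral_deriv_of_contDiffOn_Icc (hF.comp hd hmc) hbc
    rw [← kobayashiLength_add h.le hbc, ← sub_add_sub_cancel' (F (γ b))]
    refine (enorm_add_le _ _).trans (add_le_add h1 (h2.trans ?_))
    rw [kobayashiLength, ← restrict_Ioo_eq_restrict_Icc]
    refine setLIntegral_mono_ae' measurableSet_Ioo (ae_of_all _ fun t ht => ?_)
    have hmem := hmc (Ioo_subset_Icc_self ht)
    have hγt : DifferentiableAt ℝ γ t :=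
      (hd.differentiableOn one_ne_zero).differentiableAt (Icc_mem_nhds ht.1 ht.2)
    have hFt : DifferentiableAt ℝ F (γ t) :=
      (hF.differentiableOn one_ne_zero).differentiableAt (hD.mem_nhds hmem)
    rw [(hFt.hasFDerivAt.comp_hasDerivAt t hγt.hasDerivAt).deriv, ← ofReal_norm]
    exact ENNReal.ofReal_le_ofReal (hF' _ hmem _)

theorem enorm_sub_le_kobayashiEDist {G : Type*} [NormedAddCommGroup G] [NormedSpace ℝ G]
    (hD : IsOpen D) {F : EuclideanSpace ℂ (Fin n) → G} (hF : ContDiffOn ℝ 1 F D)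
    (hF' : ∀ z ∈ D, ∀ X, ‖fderiv ℝ F z X‖ ≤ kobayashiRoyden D z X)
    (x y : EuclideanSpace ℂ (Fin n)) : ‖F y - F x‖ₑ ≤ kobayashiEDist D x y := by
  refine le_of_forall_gt fun r hr => ?_
  obtain ⟨γ, h, hm, rfl, rfl, hl⟩ := exists_curve_of_kobayashiEDist_lt hr
  exact (enorm_sub_le_kobayashiLength hD hF hF' h hm).trans_lt hl

theorem kobayashiEDist_le_of_segment (hD : IsOpen D) {M : ℝ}
    (hs : ∀ t ∈ Icc (0 : ℝ) 1, AffineMap.lineMap x y t ∈ D)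
    (hM : ∀ t ∈ Icc (0 : ℝ) 1, kobayashiRoyden D (AffineMap.lineMap x y t) (y - x) ≤ M) :
    kobayashiEDist D x y ≤ ENNReal.ofReal M := by
  have h := kobayashiEDist_le_kobayashiLength (D := D) hD
    (PiecewiseC1.of_contDiffOn zero_le_one (AffineMap.contDiff_lineMap x y).contDiffOn)
    hs
  rw [AffineMap.lineMap_apply_zero, AffineMap.lineMap_apply_one] at h
  refine h.trans ((setLIntegral_mono' (g := fun _ => ENNReal.ofReal M) measurableSet_Ioo
    fun t ht => ?_).trans_eq ?_)
  · rw [AffineMap.hasDerivAt_lineMap.deriv]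
    exact ENNReal.ofReal_le_ofReal (hM t (Ioo_subset_Icc_self ht))
  · simp

theorem kobayashiEDist_le_of_thickening (hD : IsOpen D) {r : ℝ} (hr : 0 < r)
    (hs : ∀ t ∈ Icc (0 : ℝ) 1, Metric.ball (AffineMap.lineMap x y t) r ⊆ D) :
    kobayashiEDist D x y ≤ ENNReal.ofReal (‖y - x‖ / r) :=
  kobayashiEDist_le_of_segment hD (fun t ht => hs t ht (Metric.mem_ball_self hr))
    fun t ht => kobayashiRoyden_le_of_ball_subset hr (hs t ht)

/-- The segment is compact in `D`, so balls of one radius about its points fit in `D`. Finiteness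
matters because `toReal` sends ∞ to 0. -/
theorem kobayashiEDist_ne_top (hD : IsOpen D) (hc : Convex ℝ D) (hx : x ∈ D) (hy : y ∈ D) :
    kobayashiEDist D x y ≠ ⊤ := by
  have hK : IsCompact (AffineMap.lineMap x y '' Icc (0 : ℝ) 1) :=
    isCompact_Icc.image (AffineMap.lineMap_continuous)
  have hKD : AffineMap.lineMap x y '' Icc (0 : ℝ) 1 ⊆ D := by
    rintro _ ⟨t, ht, rfl⟩
    exact hc.lineMap_mem hx hy ht
  obtain ⟨r, hr, hrD⟩ := hK.exists_thickening_subset_open hD hKD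
  refine ne_top_of_le_ne_top ENNReal.ofReal_ne_top
    (kobayashiEDist_le_of_thickening hD hr fun t ht => ?_)
  exact (Metric.ball_subset_thickening (mem_image_of_mem _ ht) r).trans hrD

theorem kobayashiDist_self (hx : x ∈ D) : kobayashiDist D x x = 0 := by
  simp [kobayashiDist, kobayashiEDist_self hx]

theorem kobayashiDist_nonneg : 0 ≤ kobayashiDist D x y := ENNReal.toReal_nonneg

theorem kobayashiDist_comm (hD : IsOpen D) (x y : EuclideanSpace ℂ (Fin n)) :
    kobayashiDist D x y = kobayashiDist D y x := by
  rw [kobayashiDist, kobayashiEDist_comm hD, kobayashiDist]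

theorem kobayashiDist_triangle (hD : IsOpen D) (hc : Convex ℝ D) (hx : x ∈ D) (hy : y ∈ D)
    (hz : z ∈ D) : kobayashiDist D x z ≤ kobayashiDist D x y + kobayashiDist D y z := by
  have h1 := kobayashiEDist_ne_top hD hc hx hy
  have h2 := kobayashiEDist_ne_top hD hc hy hz
  rw [kobayashiDist, kobayashiDist, kobayashiDist, ← ENNReal.toReal_add h1 h2]
  exact ENNReal.toReal_mono (ENNReal.add_ne_top.2 ⟨h1, h2⟩) (kobayashiEDist_triangle hD x y z)

theorem norm_sub_le_kobayashiDist {G : Type*} [NormedAddCommGroup G] [NormedSpace ℝ G]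
    (hD : IsOpen D) (hc : Convex ℝ D) {F : EuclideanSpace ℂ (Fin n) → G} (hF : ContDiffOn ℝ 1 F D)
    (hF' : ∀ z ∈ D, ∀ X, ‖fderiv ℝ F z X‖ ≤ kobayashiRoyden D z X) (hx : x ∈ D) (hy : y ∈ D) :
    ‖F y - F x‖ ≤ kobayashiDist D x y := by
  rw [← toReal_enorm, kobayashiDist]
  exact ENNReal.toReal_mono (kobayashiEDist_ne_top hD hc hx hy)
    (enorm_sub_le_kobayashiEDist hD hF hF' x y)

theorem norm_sub_le_mul_kobayashiDist (hD : IsOpen D) (hc : Convex ℝ D) {R : ℝ} (hR : 0 < R)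
    (hDR : D ⊆ Metric.ball 0 R) (hx : x ∈ D) (hy : y ∈ D) :
    ‖y - x‖ ≤ 2 * R * kobayashiDist D x y := by
  have h := norm_sub_le_kobayashiDist (F := fun z => (2 * R)⁻¹ • z) hD hc
    (contDiff_id.const_smul (2 * R)⁻¹).contDiffOn (fun z hz X => ?_) hx hy
  · rw [← smul_sub, norm_smul, norm_inv, Real.norm_of_nonneg (by positivity)] at h
    rwa [inv_mul_le_iff₀ (by positivity)] at h
  · have : HasFDerivAt (fun z : EuclideanSpace ℂ (Fin n) => (2 * R)⁻¹ • z)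
      ((2 * R)⁻¹ • ContinuousLinearMap.id ℝ _) z := (hasFDerivAt_id z).const_smul (2 * R)⁻¹
    rw [this.fderiv]
    simp only [smul_apply, ContinuousLinearMap.id_apply, norm_smul, norm_inv]
    rw [Real.norm_of_nonneg (by positivity), inv_mul_le_iff₀ (by positivity)]
    exact norm_le_mul_kobayashiRoyden hD hz hR hDR

/-- The Kobayashi distance dominates the hyperbolic distance of the distances to a supporting
hyperplane. -/
theorem log_div_le_kobayashiDist (hD : IsOpen D) (hc : Convex ℝ D)
    (f : EuclideanSpace ℂ (Fin n) →L[ℂ] ℂ) {c : ℝ} (hf : ∀ w ∈ D, (f w).re < c) (hx : x ∈ D)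
    (hy : y ∈ D) : Real.log ((c - (f x).re) / (c - (f y).re)) / 2 ≤ kobayashiDist D x y := by
  set g : EuclideanSpace ℂ (Fin n) →L[ℝ] ℝ := Complex.reCLM.comp (f.restrictScalars ℝ) with hg
  have hgf : ∀ w, g w = (f w).re := fun w => rfl
  have hne : ∀ w ∈ D, c - g w ≠ 0 := fun w hw => (sub_pos.2 (hf w hw)).ne'
  have h := norm_sub_le_kobayashiDist (F := fun w => Real.log (c - g w) / 2) hD hc
    (((contDiff_const.sub g.contDiff).contDiffOn.log hne).div_const 2) (fun w hw X => ?_) hx hy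
  · rw [← hgf, ← hgf, Real.log_div (hne x hx) (hne y hy)]
    rw [Real.norm_eq_abs, abs_le] at h
    linarith [h.1]
  · have hpos : 0 < c - g w := sub_pos.2 (hf w hw)
    have hd : HasFDerivAt (fun w => Real.log (c - g w) / 2)
        ((2 : ℝ)⁻¹ • ((c - g w)⁻¹ • (-g))) w := by
      have := ((g.hasFDerivAt (x := w)).const_sub c).log (hne w hw)
      simpa only [div_eq_inv_mul, smul_eq_mul] using this.fun_const_smul (2 : ℝ)⁻¹
    rw [hd.fderiv]
    have key := norm_apply_le_mul_kobayashiRoyden (X := X) hD hw f hf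
    have hre : |g X| ≤ ‖f X‖ := Complex.abs_re_le_norm _
    rw [← hgf] at key
    simp only [_root_.smul_apply, _root_.neg_apply, smul_eq_mul,
      norm_mul, norm_inv, norm_neg, Real.norm_eq_abs, abs_of_pos hpos]
    rw [abs_of_pos (by norm_num : (0 : ℝ) < 2), ← mul_assoc, ← mul_inv,
      inv_mul_le_iff₀ (by positivity)]
    exact hre.trans key

/-- By the triangle inequality it is enough that k(x, w) → 0 as w → x, which inscribed balls give.
-/
theorem continuousOn_kobayashiDist (hD : IsOpen D) (hc : Convex ℝ D) :
    ContinuousOn (fun p : EuclideanSpace ℂ (Fin n) × EuclideanSpace ℂ (Fin n) =>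
      kobayashiDist D p.1 p.2) (D ×ˢ D) := by
  have hloc : ∀ x ∈ D, Tendsto (fun w => kobayashiDist D x w) (𝓝 x) (𝓝 0) := by
    intro x hx
    obtain ⟨r, hr, hrD⟩ := Metric.isOpen_iff.1 hD x hx
    have hlim : Tendsto (fun w => ‖w - x‖ / (r / 2)) (𝓝 x) (𝓝 0) := by
      have : Continuous fun w : EuclideanSpace ℂ (Fin n) => ‖w - x‖ / (r / 2) := by fun_prop
      simpa using this.tendsto x
    refine squeeze_zero' (Eventually.of_forall fun w => kobayashiDist_nonneg) ?_ hlim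
    filter_upwards [Metric.ball_mem_nhds x (half_pos hr)] with w hw
    refine ENNReal.toReal_le_of_le_ofReal (by positivity)
      (kobayashiEDist_le_of_thickening hD (half_pos hr) fun t ht => ?_)
    refine (Metric.ball_subset_ball' ?_).trans hrD
    have := (convex_ball x (r / 2)).lineMap_mem (Metric.mem_ball_self (half_pos hr)) hw ht
    rw [Metric.mem_ball] at this
    linarith
  rintro ⟨x, y⟩ ⟨hx, hy⟩
  rw [ContinuousWithinAt, tendsto_iff_dist_tendsto_zero]
  have hsum : Tendsto (fun p : EuclideanSpace ℂ (Fin n) × EuclideanSpace ℂ (Fin n) =>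
      kobayashiDist D x p.1 + kobayashiDist D y p.2) (𝓝[D ×ˢ D] (x, y)) (𝓝 0) := by
    have := ((hloc x hx).comp (continuous_fst.tendsto (x, y))).add
      ((hloc y hy).comp (continuous_snd.tendsto (x, y)))
    rw [add_zero] at this
    exact this.mono_left nhdsWithin_le_nhds
  refine squeeze_zero' (Eventually.of_forall fun p => dist_nonneg) ?_ hsum
  filter_upwards [self_mem_nhdsWithin] with p hp
  obtain ⟨h1, h2⟩ := hp
  have a1 := kobayashiDist_triangle hD hc h1 hx h2
  have a2 := kobayashiDist_triangle hD hc hx hy h2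
  have a3 := kobayashiDist_triangle hD hc hx h1 hy
  have a4 := kobayashiDist_triangle hD hc h1 h2 hy
  rw [kobayashiDist_comm hD p.1 x] at a1
  rw [kobayashiDist_comm hD p.2 y] at a4
  rw [Real.dist_eq, abs_le]
  constructor <;> linarith

theorem continuousOn_kobayashiDist_right (hD : IsOpen D) (hc : Convex ℝ D) (hx : x ∈ D) :
    ContinuousOn (fun w => kobayashiDist D x w) D :=
  (continuousOn_kobayashiDist hD hc).comp
    (f := fun w => ((x, w) : EuclideanSpace ℂ (Fin n) × EuclideanSpace ℂ (Fin n)))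
    (by fun_prop) fun _ hw => ⟨hx, hw⟩

theorem continuousOn_kobayashiDist_left (hD : IsOpen D) (hc : Convex ℝ D) (hy : y ∈ D) :
    ContinuousOn (fun w => kobayashiDist D w y) D :=
  (continuousOn_kobayashiDist hD hc).comp
    (f := fun w => ((w, y) : EuclideanSpace ℂ (Fin n) × EuclideanSpace ℂ (Fin n)))
    (by fun_prop) fun _ hw => ⟨hw, hy⟩

/-- Completeness: at a limit point outside `D`, a supporting hyperplane exists, and
`log_div_le_kobayashiDist` keeps the ball at a positive distance from it. -/
theorem isCompact_kobayashi_closedBall (hD : IsOpen D) (hc : Convex ℝ D)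
    (hb : Bornology.IsBounded D) (hx : x ∈ D) (R : ℝ) :
    IsCompact {z | z ∈ D ∧ kobayashiDist D x z ≤ R} := by
  refine Metric.isCompact_of_isClosed_isBounded (isClosed_of_closure_subset fun z hz => ?_)
    (hb.subset fun z hz => hz.1)
  have hzD : z ∈ D := by
    by_contra hzD
    obtain ⟨f, hf⟩ := RCLike.geometric_hahn_banach_open_point (𝕜 := ℂ) hc hD hzD
    have hf : ∀ w ∈ D, (f w).re < (f z).re := hf
    have hpos : 0 < (f z).re - (f x).re := sub_pos.2 (hf x hx)
    have hle : ∀ w ∈ {w | w ∈ D ∧ kobayashiDist D x w ≤ R},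
        ((f z).re - (f x).re) * Real.exp (-(2 * R)) ≤ (f z).re - (f w).re := by
      rintro w ⟨hw, hwR⟩
      have h1 := (log_div_le_kobayashiDist hD hc f hf hx hw).trans hwR
      have hwpos : 0 < (f z).re - (f w).re := sub_pos.2 (hf w hw)
      have h2 : Real.log (((f z).re - (f x).re) / ((f z).re - (f w).re)) ≤ 2 * R := by linarith
      rw [Real.log_le_iff_le_exp (by positivity), div_le_iff₀ hwpos] at h2
      rw [Real.exp_neg, ← div_eq_mul_inv, div_le_iff₀ (Real.exp_pos _)]
      linarith
    have hcl : IsClosed {w | ((f z).re - (f x).re) * Real.exp (-(2 * R)) ≤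
        (f z).re - (f w).re} :=
      isClosed_le continuous_const
        (continuous_const.sub (Complex.continuous_re.comp f.continuous))
    have : _ ≤ (f z).re - (f z).re := closure_minimal hle hcl hz
    rw [sub_self] at this
    exact absurd this (not_le.2 (mul_pos hpos (Real.exp_pos _)))
  refine ⟨hzD, ?_⟩
  have hcont := continuousOn_kobayashiDist_right hD hc hx z hzD
  exact (hcont.mono fun w hw => hw.1).closure_le hz continuousWithinAt_const fun w hw => hw.2

/-- Intermediate value theorem along a curve of length less than k(x, y) + ε. -/
theorem exists_between_kobayashiDist_le (hD : IsOpen D) (hc : Convex ℝ D) (hx : x ∈ D)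
    (hy : y ∈ D) {t : ℝ} (ht : t ∈ Icc 0 (kobayashiDist D x y)) {ε : ℝ} (hε : 0 < ε) :
    ∃ z ∈ D, kobayashiDist D x z = t ∧ kobayashiDist D z y ≤ kobayashiDist D x y - t + ε := by
  have hxy := kobayashiEDist_ne_top hD hc hx hy
  obtain ⟨γ, h, hm, h0, h1, hl⟩ := exists_curve_of_kobayashiEDist_lt
    (ENNReal.lt_add_right hxy (ENNReal.ofReal_pos.2 hε).ne')
  have hcont : ContinuousOn (fun s => kobayashiDist D x (γ s)) (Icc 0 1) :=
    (continuousOn_kobayashiDist_right hD hc hx).comp h.continuousOn hm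
  have hivt := intermediate_value_Icc zero_le_one hcont
  simp only [h0, h1, kobayashiDist_self hx] at hivt
  obtain ⟨s, hs, hst⟩ := hivt ht
  refine ⟨γ s, hm hs, hst, ?_⟩
  obtain ⟨p1, p2⟩ := h.split hs
  have e1 := kobayashiEDist_le_kobayashiLength hD p1 (hm.mono_left (Icc_subset_Icc le_rfl hs.2))
  have e2 := kobayashiEDist_le_kobayashiLength hD p2 (hm.mono_left (Icc_subset_Icc hs.1 le_rfl))
  have e3 := ((add_le_add e1 e2).trans_eq (kobayashiLength_add hs.1 hs.2)).trans hl.le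
  rw [h0, h1] at e3
  have e4 := ENNReal.toReal_mono (ENNReal.add_ne_top.2 ⟨hxy, ENNReal.ofReal_ne_top⟩) e3
  rw [ENNReal.toReal_add (kobayashiEDist_ne_top hD hc hx (hm hs))
    (kobayashiEDist_ne_top hD hc (hm hs) hy), ENNReal.toReal_add hxy ENNReal.ofReal_ne_top,
    ENNReal.toReal_ofReal hε.le] at e4
  simp only [kobayashiDist] at hst ⊢
  linarith

/-- The ε disappears by minimizing the distance to `y` over the sphere of radius `t` about `x`,
which is compact. -/
theorem exists_between_kobayashiDist (hD : IsOpen D) (hc : Convex ℝ D)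
    (hb : Bornology.IsBounded D) (hx : x ∈ D) (hy : y ∈ D) {t : ℝ}
    (ht : t ∈ Icc 0 (kobayashiDist D x y)) :
    ∃ z ∈ D, kobayashiDist D x z = t ∧ kobayashiDist D z y = kobayashiDist D x y - t := by
  set B := {z | z ∈ D ∧ kobayashiDist D x z ≤ t} with hB
  have hK : IsCompact B := isCompact_kobayashi_closedBall hD hc hb hx t
  have hBD : B ⊆ D := fun w hw => hw.1
  set S := B ∩ (fun w => kobayashiDist D x w) ⁻¹' {t} with hS
  have hK' : IsCompact S := hK.of_isClosed_subset
    (((continuousOn_kobayashiDist_right hD hc hx).mono hBD).preimage_isClosed_of_isClosed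
      hK.isClosed isClosed_singleton) inter_subset_left
  have hne : ∀ ε > 0, ∃ z ∈ S, kobayashiDist D z y ≤ kobayashiDist D x y - t + ε := by
    intro ε hε
    obtain ⟨z, hz, hzt, hzy⟩ := exists_between_kobayashiDist_le hD hc hx hy ht hε
    exact ⟨z, ⟨⟨hz, hzt.le⟩, hzt⟩, hzy⟩
  obtain ⟨z₁, hz₁, -⟩ := hne 1 one_pos
  obtain ⟨z, hz, hmin⟩ := hK'.exists_isMinOn ⟨z₁, hz₁⟩
    ((continuousOn_kobayashiDist_left hD hc hy).mono (inter_subset_left.trans hBD))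
  have hzt : kobayashiDist D x z = t := hz.2
  refine ⟨z, hz.1.1, hzt, le_antisymm (le_of_forall_pos_le_add fun ε hε => ?_) ?_⟩
  · obtain ⟨w, hw, hwy⟩ := hne ε hε
    exact (isMinOn_iff.1 hmin w hw).trans hwy
  · linarith [kobayashiDist_triangle hD hc hx hz.1.1 hy]

end Distance

/-! ### Existence of geodesics in bounded convex domains. -/

section Geodesics

variable {n : ℕ} {D : Set (EuclideanSpace ℂ (Fin n))} {x y : EuclideanSpace ℂ (Fin n)}

/-- The largest parameter is placed between `x` and `y`, and the others between `x` and that point.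
The distance to `y` is recorded since it drives the induction. -/
theorem exists_isometric_on_finset (hD : IsOpen D) (hc : Convex ℝ D)
    (hb : Bornology.IsBounded D) (hx : x ∈ D) (F : Finset ℝ) :
    ∀ y ∈ D, (∀ s ∈ F, s ∈ Icc 0 (kobayashiDist D x y)) →
      ∃ σ : ℝ → EuclideanSpace ℂ (Fin n),
        (∀ s, σ s ∈ D ∧ kobayashiDist D x (σ s) ≤ kobayashiDist D x y) ∧
        ∀ s ∈ F, kobayashiDist D x (σ s) = s ∧
          kobayashiDist D (σ s) y = kobayashiDist D x y - s ∧
          ∀ t ∈ F, kobayashiDist D (σ s) (σ t) = |s - t| := by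
  induction F using Finset.induction_on_max with
  | empty =>
    intro y _ _
    exact ⟨fun _ => x, fun _ => ⟨hx, by rw [kobayashiDist_self hx]; exact kobayashiDist_nonneg⟩,
      by simp⟩
  | insert a F hmax ih =>
    intro y hy hF
    have ha := hF a (Finset.mem_insert_self a F)
    obtain ⟨z, hz, hxz, hzy⟩ := exists_between_kobayashiDist hD hc hb hx hy ha
    obtain ⟨σ, hσ, hσF⟩ := ih z hz fun s hs =>
      ⟨(hF s (Finset.mem_insert_of_mem hs)).1, by rw [hxz]; exact (hmax s hs).le⟩
    have hσa : ∀ s ∈ F, Function.update σ a z s = σ s := fun s hs =>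
      Function.update_of_ne (hmax s hs).ne _ _
    refine ⟨Function.update σ a z, fun s => ?_, fun s hs => ?_⟩
    · rcases eq_or_ne s a with rfl | hsa
      · rw [Function.update_self]
        exact ⟨hz, hxz.trans_le ha.2⟩
      · rw [Function.update_of_ne hsa]
        exact ⟨(hσ s).1, (hσ s).2.trans (hxz.trans_le ha.2)⟩
    · rw [Finset.mem_insert] at hs
      rcases hs with rfl | hs
      · rw [Function.update_self]
        refine ⟨hxz, hzy, fun t ht => ?_⟩
        rw [Finset.mem_insert] at ht
        rcases ht with rfl | ht
        · rw [Function.update_self, kobayashiDist_self hz, sub_self, abs_zero]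
        · rw [hσa t ht, kobayashiDist_comm hD, (hσF t ht).2.1, hxz,
            abs_of_pos (sub_pos.2 (hmax t ht))]
      · rw [hσa s hs]
        obtain ⟨h1, h2, h3⟩ := hσF s hs
        refine ⟨h1, ?_, fun t ht => ?_⟩
        · have t1 := kobayashiDist_triangle hD hc (hσ s).1 hz hy
          have t2 := kobayashiDist_triangle hD hc hx (hσ s).1 hy
          linarith
        · rw [Finset.mem_insert] at ht
          rcases ht with rfl | ht
          · rw [Function.update_self, h2, hxz, abs_sub_comm, abs_of_pos (sub_pos.2 (hmax s hs))]
          · rw [hσa t ht]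
            exact h3 t ht

/-- Any two points of a bounded convex domain are joined by a geodesic. -/
theorem exists_isKobayashiGeodesic (hD : IsOpen D) (hc : Convex ℝ D)
    (hb : Bornology.IsBounded D) (hx : x ∈ D) (hy : y ∈ D) :
    ∃ σ : ℝ → EuclideanSpace ℂ (Fin n), IsKobayashiGeodesic D (kobayashiDist D x y) σ ∧
      σ 0 = x ∧ σ (kobayashiDist D x y) = y := by
  obtain ⟨R, hR, hDR⟩ := hb.subset_ball_lt 0 0
  set L := kobayashiDist D x y with hL
  set B := {z | z ∈ D ∧ kobayashiDist D x z ≤ L} with hB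
  have hBc : IsCompact B := isCompact_kobayashi_closedBall hD hc hb hx L
  set K : Set (ℝ → EuclideanSpace ℂ (Fin n)) := Set.pi univ fun _ => B with hK
  have hKc : IsCompact K := isCompact_univ_pi fun _ => hBc
  have hKD : ∀ σ ∈ K, ∀ s, σ s ∈ D := fun σ hσ s => (hσ s (mem_univ s)).1
  have heval : ∀ s : ℝ, ContinuousOn (fun σ : ℝ → EuclideanSpace ℂ (Fin n) => σ s) K :=
    fun s => (continuous_apply s).continuousOn
  have hcont : ∀ s t : ℝ, ContinuousOn (fun σ : ℝ → EuclideanSpace ℂ (Fin n) =>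
      (kobayashiDist D x (σ s), kobayashiDist D (σ s) y, kobayashiDist D (σ s) (σ t))) K := by
    intro s t
    have c₁ := ContinuousOn.comp (g := fun w => kobayashiDist D x w) (t := D)
      (continuousOn_kobayashiDist_right hD hc hx) (heval s) fun σ hσ => hKD σ hσ s
    have c₂ := ContinuousOn.comp (g := fun w => kobayashiDist D w y) (t := D)
      (continuousOn_kobayashiDist_left hD hc hy) (heval s) fun σ hσ => hKD σ hσ s
    have c₃ := ContinuousOn.comp
      (g := fun p : EuclideanSpace ℂ (Fin n) × EuclideanSpace ℂ (Fin n) => kobayashiDist D p.1 p.2)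
      (t := D ×ˢ D) (continuousOn_kobayashiDist hD hc) ((heval s).prodMk (heval t))
      fun σ hσ => ⟨hKD σ hσ s, hKD σ hσ t⟩
    exact c₁.prodMk (c₂.prodMk c₃)
  -- Each pair of parameters imposes a closed condition on the compact product `K`; the finite
  -- intersection property comes from `exists_isometric_on_finset`.
  obtain ⟨σ, hσK, hσ⟩ := hKc.inter_iInter_nonempty
    (fun i : Icc (0 : ℝ) L × Icc (0 : ℝ) L =>
      K ∩ (fun σ : ℝ → EuclideanSpace ℂ (Fin n) => (kobayashiDist D x (σ i.1),
        kobayashiDist D (σ i.1) y, kobayashiDist D (σ i.1) (σ i.2))) ⁻¹'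
          {((i.1 : ℝ), L - (i.1 : ℝ), |(i.1 : ℝ) - i.2|)})
    (fun i => (hcont _ _).preimage_isClosed_of_isClosed hKc.isClosed isClosed_singleton) (by
      classical
      intro u
      obtain ⟨σ, h1, h2⟩ := exists_isometric_on_finset hD hc hb hx
        (u.image (fun i => (i.1 : ℝ)) ∪ u.image (fun i => (i.2 : ℝ))) y hy (by
          intro s hs
          simp only [Finset.mem_union, Finset.mem_image] at hs
          rcases hs with ⟨i, -, rfl⟩ | ⟨i, -, rfl⟩
          · exact i.1.2
          · exact i.2.2)
      have hσK : σ ∈ K := fun s _ => h1 s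
      refine ⟨σ, hσK, mem_iInter₂.2 fun i hi => ⟨hσK, ?_⟩⟩
      obtain ⟨a1, a2, a3⟩ := h2 i.1 (Finset.mem_union_left _ (Finset.mem_image_of_mem _ hi))
      have a4 := a3 i.2 (Finset.mem_union_right _ (Finset.mem_image_of_mem _ hi))
      exact Prod.ext a1 (Prod.ext a2 a4))
  have hprop : ∀ s ∈ Icc 0 L, ∀ t ∈ Icc 0 L, kobayashiDist D x (σ s) = s ∧
      kobayashiDist D (σ s) y = L - s ∧ kobayashiDist D (σ s) (σ t) = |s - t| := by
    intro s hs t ht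
    have h : (_, _, _) = (_, _, _) := (mem_iInter.1 hσ (⟨s, hs⟩, ⟨t, ht⟩)).2
    simpa only [Prod.mk.injEq] using h
  have hL0 : 0 ≤ L := kobayashiDist_nonneg
  have hsep : ∀ z ∈ D, ∀ w ∈ D, kobayashiDist D z w = 0 → z = w := by
    intro z hz w hw h
    have := norm_sub_le_mul_kobayashiDist hD hc hR hDR hz hw
    rw [h, mul_zero] at this
    exact (sub_eq_zero.1 (norm_le_zero_iff.1 this)).symm
  have hl := left_mem_Icc.2 hL0
  have hr := right_mem_Icc.2 hL0
  refine ⟨σ, ⟨?_, fun s _ => hKD σ hσK s, fun s hs t ht => (hprop s hs t ht).2.2⟩,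
    (hsep _ hx _ (hKD σ hσK 0) (hprop 0 hl 0 hl).1).symm,
    hsep _ (hKD σ hσK L) _ hy ((hprop L hr L hr).2.1.trans (sub_self L))⟩
  -- An isometry for k is 2R-Lipschitz for the Euclidean norm.
  refine (LipschitzOnWith.of_dist_le_mul (K := (2 * R).toNNReal) fun s hs t ht => ?_).continuousOn
  rw [dist_eq_norm, Real.coe_toNNReal _ (by positivity), Real.dist_eq,
    ← (hprop s hs t ht).2.2, kobayashiDist_comm hD]
  exact norm_sub_le_mul_kobayashiDist hD hc hR hDR (hKD σ hσK t) (hKD σ hσK s)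

end Geodesics

/-! ### An almost extremal disc in a strip, truncated to bounded height. -/

section Strip

/-- A holomorphic disc in the rectangle `|Re| < x`, `|Im| ≤ 1` that is almost extremal for the
vertical direction in the strip `|Re| < x`. -/
theorem exists_disc_in_rectangle {x : ℝ} (hx : 0 < x) :
    ∃ (α h' : ℂ) (h : ℂ → ℂ), DifferentiableOn ℂ h (Metric.ball 0 1) ∧ h 0 = 0 ∧
      HasDerivAt h h' 0 ∧ α * h' = -2 * Complex.I ∧ ‖α‖ ≤ Real.pi / (2 * x) + 2 ∧
      ∀ ζ ∈ Metric.ball (0 : ℂ) 1, |(h ζ).re| < x ∧ |(h ζ).im| ≤ 1 := by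
  have hpi := Real.pi_pos
  set u : ℝ := Real.pi / (2 * x) with hu
  have hu0 : 0 < u := by positivity
  set T : ℝ := Real.exp u with hT
  have hT1 : 1 + u ≤ T := by linarith [Real.add_one_le_exp u]
  -- Shrinking by r = tanh(u/2) makes (1 + r)/(1 - r) = e^u, so |log ‖w‖| ≤ u and, after scaling by
  -- c = 1/u, |Im h| ≤ 1.
  set r : ℝ := (T - 1) / (T + 1) with hr
  have hr0 : 0 < r := div_pos (by linarith) (by linarith)
  have hr1 : r < 1 := (div_lt_one (by linarith)).2 (by linarith)
  have hrT : 1 + r = T * (1 - r) := by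
    rw [hr]
    field_simp [show T + 1 ≠ 0 by linarith]
    ring
  set c : ℝ := u⁻¹ with hc
  have hc0 : 0 < c := inv_pos.2 hu0
  have hc' : (c : ℂ) ≠ 0 := by exact_mod_cast hc0.ne'
  have hr' : (r : ℂ) ≠ 0 := by exact_mod_cast hr0.ne'
  have hnorm : ∀ ζ ∈ Metric.ball (0 : ℂ) 1, ‖(r : ℂ) * ζ‖ ≤ r := by
    intro ζ hζ
    rw [mem_ball_zero_iff] at hζ
    rw [norm_mul, Complex.norm_real, Real.norm_of_nonneg hr0.le]
    nlinarith
  have hre : ∀ ζ ∈ Metric.ball (0 : ℂ) 1, 0 < 1 - ((r : ℂ) * ζ).re ∧ 0 < 1 + ((r : ℂ) * ζ).re := by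
    intro ζ hζ
    have := abs_le.1 ((Complex.abs_re_le_norm _).trans (hnorm ζ hζ))
    constructor <;> linarith [this.1, this.2]
  have hden : ∀ ζ ∈ Metric.ball (0 : ℂ) 1, 1 - (r : ℂ) * ζ ≠ 0 := by
    intro ζ hζ h
    have := congrArg Complex.re h
    rw [Complex.sub_re, Complex.one_re, Complex.zero_re] at this
    linarith [(hre ζ hζ).1]
  set w : ℂ → ℂ := fun ζ => (1 + r * ζ) / (1 - r * ζ) with hw
  have hwre : ∀ ζ ∈ Metric.ball (0 : ℂ) 1, 0 < (w ζ).re := by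
    intro ζ hζ
    have hn := Complex.normSq_pos.2 (hden ζ hζ)
    have h2 : Complex.normSq ((r : ℂ) * ζ) < 1 := by
      rw [← Complex.sq_norm]
      nlinarith [hnorm ζ hζ, norm_nonneg ((r : ℂ) * ζ)]
    rw [Complex.normSq_apply] at h2
    rw [hw, Complex.div_re, ← add_div]
    apply div_pos _ hn
    simp only [Complex.add_re, Complex.sub_re, Complex.one_re, Complex.add_im, Complex.sub_im,
      Complex.one_im]
    nlinarith
  have hwslit : ∀ ζ ∈ Metric.ball (0 : ℂ) 1, w ζ ∈ Complex.slitPlane := fun ζ hζ =>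
    Or.inl (hwre ζ hζ)
  have hwd : DifferentiableOn ℂ w (Metric.ball 0 1) :=
    DifferentiableOn.div (by fun_prop) (by fun_prop) hden
  have h0 : (0 : ℂ) ∈ Metric.ball (0 : ℂ) 1 := by simp
  have hw' : HasDerivAt w (2 * r) 0 := by
    have e : HasDerivAt (fun ζ : ℂ => (r : ℂ) * ζ) r 0 := by
      simpa using (hasDerivAt_id (0 : ℂ)).const_mul (r : ℂ)
    refine ((e.const_add 1).div (e.const_sub 1) (hden 0 h0)).congr_deriv ?_
    simp only [mul_zero]
    ring
  refine ⟨-((c : ℂ) * r)⁻¹, Complex.I * c * (2 * r), fun ζ => Complex.I * c * Complex.log (w ζ),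
    (hwd.clog hwslit).const_mul _, by simp [hw], ?_, ?_, ?_, fun ζ hζ => ?_⟩
  · have := (hw'.clog (hwslit 0 h0)).const_mul (Complex.I * c)
    refine this.congr_deriv ?_
    simp [hw]
  · field_simp
  -- Here ‖α‖ = u/r = u + 2u/(T - 1), and T - 1 ≥ u: the truncation costs at most 2.
  · rw [norm_neg, norm_inv, norm_mul, Complex.norm_real, Complex.norm_real,
      Real.norm_of_nonneg hc0.le, Real.norm_of_nonneg hr0.le, hc, hr, mul_inv, inv_inv, inv_div,
      mul_div_assoc', div_le_iff₀ (by linarith)]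
    nlinarith
  · have him : (Complex.I * c * Complex.log (w ζ)).im = c * Real.log ‖w ζ‖ := by
      simp [mul_assoc, Complex.log_re]
    have hre' : (Complex.I * c * Complex.log (w ζ)).re = -(c * (w ζ).arg) := by
      simp [mul_assoc, Complex.log_im]
    constructor
    · have harg : |(w ζ).arg| < Real.pi / 2 :=
        Complex.abs_arg_lt_pi_div_two_iff.2 (Or.inl (hwre ζ hζ))
      dsimp only
      rw [hre', abs_neg, abs_mul, abs_of_pos hc0]
      calc c * |(w ζ).arg| < c * (Real.pi / 2) := by gcongr
        _ = x := by rw [hc, hu]; field_simp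
    · dsimp only
      rw [him, abs_mul, abs_of_pos hc0, hc, inv_mul_le_iff₀ hu0, mul_one, abs_le]
      have n1 : ‖1 + (r : ℂ) * ζ‖ ≤ 1 + r :=
        (norm_add_le _ _).trans (by rw [norm_one]; gcongr; exact hnorm ζ hζ)
      have n2 : ‖1 - (r : ℂ) * ζ‖ ≤ 1 + r :=
        (norm_sub_le _ _).trans (by rw [norm_one]; gcongr; exact hnorm ζ hζ)
      have n3 : 1 - r ≤ ‖1 + (r : ℂ) * ζ‖ := by
        have := norm_sub_le (1 + (r : ℂ) * ζ) ((r : ℂ) * ζ)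
        rw [add_sub_cancel_right, norm_one] at this
        linarith [hnorm ζ hζ]
      have n4 : 1 - r ≤ ‖1 - (r : ℂ) * ζ‖ := by
        have := norm_add_le (1 - (r : ℂ) * ζ) ((r : ℂ) * ζ)
        rw [sub_add_cancel, norm_one] at this
        linarith [hnorm ζ hζ]
      have hnum : 0 < ‖1 + (r : ℂ) * ζ‖ := by linarith
      have hdenp : 0 < ‖1 - (r : ℂ) * ζ‖ := by linarith
      have hTpos : 0 < T := Real.exp_pos u
      rw [hw, norm_div]
      constructor
      · rw [Real.le_log_iff_exp_le (div_pos hnum hdenp), le_div_iff₀ hdenp, Real.exp_neg, ← hT,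
          inv_mul_le_iff₀ hTpos]
        nlinarith
      · rw [Real.log_le_iff_le_exp (div_pos hnum hdenp), div_le_iff₀ hdenp, ← hT]
        nlinarith

end Strip

/-! ### The model domain: flat slices, the half-plane Re z₂ > 0, and the two estimates. -/

theorem IsProfile.pos {f : ℝ → ℝ} (hf : IsProfile f) {x : ℝ} (hx : 0 < x) : 0 < f x := by
  have := hf.strictMonoOn (mem_Ici.2 le_rfl) (mem_Ici.2 hx.le) hx
  rwa [hf.map_zero] at this

theorem IsProfile.lt_of_abs_lt {f : ℝ → ℝ} (hf : IsProfile f) {x y : ℝ} (h : |y| < x) :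
    f y < f x := by
  have h1 : f |y| = f y := by
    rcases abs_choice y with h | h <;> rw [h]
    exact hf.even y
  rw [← h1]
  exact hf.strictMonoOn (mem_Ici.2 (abs_nonneg y)) (mem_Ici.2 ((abs_nonneg y).trans h.le)) h

namespace IsModelDomain

variable {ψ χ₁ χ₂ : ℝ → ℝ} {Ω : Set (EuclideanSpace ℂ (Fin 2))}

/-- The χ₁ term vanishes for |Im z| ≤ 2, and the squared norm is at most 1 + 4 + 1 < 9. -/
theorem mem_of_abs_re_lt (hΩ : IsModelDomain ψ χ₁ χ₂ Ω) (hψ : IsProfile ψ) (hχ₁ : IsProfile χ₁)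
    (hχ₂ : IsProfile χ₂) {x : ℝ} (hx1 : x ≤ 1) (hδ : ψ x ≤ 1) {z : ℂ} (hre : |z.re| < x)
    (him : |z.im| ≤ 2) : (!₂[z, ((ψ x : ℝ) : ℂ)] : EuclideanSpace ℂ (Fin 2)) ∈ Ω := by
  refine (hΩ.inter_ball.symm.subset ⟨?_, ?_⟩).1
  · rw [← sq_lt_sq₀ (norm_nonneg _) (by norm_num), EuclideanSpace.norm_sq_eq, Fin.sum_univ_two]
    simp only [Matrix.cons_val_zero, Matrix.cons_val_one, Matrix.cons_val_fin_one]
    rw [Complex.sq_norm, Complex.normSq_apply, Complex.norm_real, Real.norm_of_nonneg (hψ.nonneg x)]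
    have h1 : z.re * z.re ≤ 1 := by
      rw [← abs_mul_abs_self]; nlinarith [abs_nonneg z.re]
    have h2 : z.im * z.im ≤ 4 := by
      rw [← abs_mul_abs_self]; nlinarith [abs_nonneg z.im]
    nlinarith [hψ.nonneg x]
  · have h1 : max (|z.im| - 2) 0 = 0 := max_eq_right (by linarith)
    simp only [Matrix.cons_val_zero, Matrix.cons_val_one, Matrix.cons_val_fin_one,
      Complex.ofReal_re, Complex.ofReal_im, h1, hχ₁.map_zero, hχ₂.map_zero, add_zero]
    exact hψ.lt_of_abs_lt hre

theorem tendsto_vertical (hψ : IsProfile ψ) (z : ℂ) :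
    Tendsto (fun x : ℝ => (!₂[z, ((ψ x : ℝ) : ℂ)] : EuclideanSpace ℂ (Fin 2))) (𝓝[>] 0)
      (𝓝 !₂[z, 0]) := by
  have hcont : Continuous ψ := hψ.contDiff.continuous
  have : Continuous (fun x : ℝ => (!₂[z, ((ψ x : ℝ) : ℂ)] : EuclideanSpace ℂ (Fin 2))) := by
    refine (PiLp.continuous_toLp 2 _).comp (continuous_pi fun i => ?_)
    fin_cases i
    · exact continuous_const
    · exact Complex.continuous_ofReal.comp hcont
  have h := this.tendsto 0
  rw [hψ.map_zero, Complex.ofReal_zero] at h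
  exact h.mono_left nhdsWithin_le_nhds

theorem eventually_mem (hΩ : IsModelDomain ψ χ₁ χ₂ Ω) (hψ : IsProfile ψ) (hχ₁ : IsProfile χ₁)
    (hχ₂ : IsProfile χ₂) :
    ∀ᶠ x : ℝ in 𝓝[>] 0, 0 < x ∧ ∀ z : ℂ, |z.re| < x → |z.im| ≤ 2 →
      (!₂[z, ((ψ x : ℝ) : ℂ)] : EuclideanSpace ℂ (Fin 2)) ∈ Ω := by
  have h1 : ∀ᶠ x : ℝ in 𝓝[>] 0, x < 1 := nhdsWithin_le_nhds (eventually_lt_nhds one_pos)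
  have h2 : ∀ᶠ x : ℝ in 𝓝[>] 0, ψ x < 1 := nhdsWithin_le_nhds
    ((hψ.contDiff.continuous.tendsto 0).eventually
      (eventually_lt_nhds (by rw [hψ.map_zero]; exact one_pos)))
  filter_upwards [h1, h2, self_mem_nhdsWithin] with x h1 h2 h3
  exact ⟨h3, fun z hre him => hΩ.mem_of_abs_re_lt hψ hχ₁ hχ₂ h1.le h2.le hre him⟩

/-- Convexity makes the local inequality global: a point near 0 on the segment from 0 to `w` lies in
the ball of radius 3. As 0 is not in Ω, it is approximated by (0, ψ(x)). -/
theorem re_nonneg (hΩ : IsModelDomain ψ χ₁ χ₂ Ω) (hψ : IsProfile ψ) (hχ₁ : IsProfile χ₁)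
    (hχ₂ : IsProfile χ₂) {w : EuclideanSpace ℂ (Fin 2)} (hw : w ∈ Ω) : 0 ≤ (w 1).re := by
  have hlim := tendsto_vertical hψ 0
  have h00 : (!₂[0, 0] : EuclideanSpace ℂ (Fin 2)) = 0 := by
    ext i; fin_cases i <;> rfl
  rw [h00] at hlim
  have hcont : Continuous fun t : ℝ => ‖(AffineMap.lineMap 0 w t : EuclideanSpace ℂ (Fin 2))‖ :=
    AffineMap.lineMap_continuous.norm
  have ht : ∀ᶠ t : ℝ in 𝓝[>] 0, ‖(AffineMap.lineMap 0 w t : EuclideanSpace ℂ (Fin 2))‖ < 3 :=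
    nhdsWithin_le_nhds ((hcont.tendsto 0).eventually (eventually_lt_nhds (by simp)))
  have ht1 : ∀ᶠ t : ℝ in 𝓝[>] 0, t < 1 := nhdsWithin_le_nhds (eventually_lt_nhds one_pos)
  obtain ⟨t, ht3, ht1, ht0⟩ := (ht.and (ht1.and self_mem_nhdsWithin)).exists
  have ht0 : 0 < t := ht0
  set P : ℝ → EuclideanSpace ℂ (Fin 2) := fun x => !₂[0, ((ψ x : ℝ) : ℂ)] with hP
  have hPlim : Tendsto (fun x => (AffineMap.lineMap (P x) w t : EuclideanSpace ℂ (Fin 2)))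
      (𝓝[>] 0) (𝓝 (AffineMap.lineMap 0 w t)) := by
    simp only [AffineMap.lineMap_apply_module]
    exact (hlim.const_smul (1 - t)).add_const _
  have hev : ∀ᶠ x : ℝ in 𝓝[>] 0,
      0 ≤ ((AffineMap.lineMap (P x) w t : EuclideanSpace ℂ (Fin 2)) 1).re := by
    filter_upwards [hPlim.norm.eventually (eventually_lt_nhds ht3),
      hΩ.eventually_mem hψ hχ₁ hχ₂] with x h1 h2
    have hmem : AffineMap.lineMap (P x) w t ∈ Ω :=
      hΩ.convex.lineMap_mem (h2.2 0 (by simpa using h2.1) (by simp)) hw ⟨ht0.le, ht1.le⟩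
    have := (hΩ.inter_ball.subset ⟨hmem, h1⟩).2
    exact ((add_nonneg (add_nonneg (hψ.nonneg _) (hχ₁.nonneg _)) (hχ₂.nonneg _)).trans_lt this).le
  have hc1 : Continuous fun z : EuclideanSpace ℂ (Fin 2) => (z 1).re := by fun_prop
  have := ge_of_tendsto ((hc1.tendsto _).comp hPlim) hev
  simp only [AffineMap.lineMap_apply_module, smul_zero, zero_add, PiLp.smul_apply,
    Complex.smul_re, smul_eq_mul] at this
  exact nonneg_of_mul_nonneg_right this ht0

theorem re_pos (hΩ : IsModelDomain ψ χ₁ χ₂ Ω) (hψ : IsProfile ψ) (hχ₁ : IsProfile χ₁)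
    (hχ₂ : IsProfile χ₂) {w : EuclideanSpace ℂ (Fin 2)} (hw : w ∈ Ω) : 0 < (w 1).re := by
  -- Openness allows `w` to be pushed slightly towards smaller Re z₂, which makes the inequality
  -- strict.
  have hcont : Continuous fun s : ℝ => w - s • (!₂[0, 1] : EuclideanSpace ℂ (Fin 2)) := by fun_prop
  have hev : ∀ᶠ s : ℝ in 𝓝[>] 0, w - s • (!₂[0, 1] : EuclideanSpace ℂ (Fin 2)) ∈ Ω :=
    nhdsWithin_le_nhds ((hcont.tendsto 0).eventually (hΩ.isOpen.mem_nhds (by simpa using hw)))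
  obtain ⟨s, hs, hs0⟩ := (hev.and self_mem_nhdsWithin).exists
  have hs0 : 0 < s := hs0
  have := hΩ.re_nonneg hψ hχ₁ hχ₂ hs
  simp at this
  linarith

theorem log_div_le (hΩ : IsModelDomain ψ χ₁ χ₂ Ω) (hψ : IsProfile ψ) (hχ₁ : IsProfile χ₁)
    (hχ₂ : IsProfile χ₂) {x y : EuclideanSpace ℂ (Fin 2)} (hx : x ∈ Ω) (hy : y ∈ Ω) :
    Real.log ((x 1).re / (y 1).re) / 2 ≤ kobayashiDist Ω x y := by
  have := log_div_le_kobayashiDist hΩ.isOpen hΩ.convex (-(EuclideanSpace.proj (1 : Fin 2)))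
    (c := 0) (fun w hw => by simpa using hΩ.re_pos hψ hχ₁ hχ₂ hw) hx hy
  simpa using this

/-- Translates of one disc serve at all points of the segment: heights at most 1 on the segment plus
1 in the disc stay within |Im z₁| ≤ 2. -/
theorem kobayashiDist_vertical_le (hΩ : IsModelDomain ψ χ₁ χ₂ Ω) {x : ℝ} (hx : 0 < x)
    (hmem : ∀ z : ℂ, |z.re| < x → |z.im| ≤ 2 →
      (!₂[z, ((ψ x : ℝ) : ℂ)] : EuclideanSpace ℂ (Fin 2)) ∈ Ω) :
    kobayashiDist Ω !₂[Complex.I, ((ψ x : ℝ) : ℂ)] !₂[-Complex.I, ((ψ x : ℝ) : ℂ)] ≤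
      Real.pi / (2 * x) + 2 := by
  have hpi := Real.pi_pos
  obtain ⟨α, h', h, hd, h0, hder, hα, hαle, hbd⟩ := exists_disc_in_rectangle hx
  have hline : ∀ t : ℝ, AffineMap.lineMap (!₂[Complex.I, ((ψ x : ℝ) : ℂ)] :
      EuclideanSpace ℂ (Fin 2)) !₂[-Complex.I, ((ψ x : ℝ) : ℂ)] t =
      !₂[Complex.I * ((1 - 2 * t : ℝ) : ℂ), ((ψ x : ℝ) : ℂ)] := by
    intro t
    rw [AffineMap.lineMap_apply_module]
    ext i
    fin_cases i
    · simp
      ring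
    · simp
      ring
  have hdisc : ∀ t ∈ Icc (0 : ℝ) 1, MapsTo (fun ζ => (!₂[Complex.I * ((1 - 2 * t : ℝ) : ℂ) + h ζ,
      ((ψ x : ℝ) : ℂ)] : EuclideanSpace ℂ (Fin 2))) (Metric.ball 0 1) Ω := by
    intro t ht ζ hζ
    obtain ⟨b1, b2⟩ := hbd ζ hζ
    refine hmem _ ?_ ?_
    · simpa using b1
    · have : (Complex.I * ((1 - 2 * t : ℝ) : ℂ) + h ζ).im = (1 - 2 * t) + (h ζ).im := by simp
      rw [this]
      rw [abs_le] at b2 ⊢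
      constructor <;> linarith [b2.1, b2.2, ht.1, ht.2]
  refine ENNReal.toReal_le_of_le_ofReal (by positivity)
    (kobayashiEDist_le_of_segment hΩ.isOpen (fun t ht => ?_) fun t ht => ?_)
  · have := hdisc t ht (Metric.mem_ball_self one_pos)
    simp only [h0, add_zero] at this
    rwa [hline]
  · rw [hline]
    have hφ' : HasDerivAt (fun ζ => (!₂[Complex.I * ((1 - 2 * t : ℝ) : ℂ) + h ζ,
        ((ψ x : ℝ) : ℂ)] : EuclideanSpace ℂ (Fin 2))) !₂[h', 0] 0 := by
      have h1 := (hder.smul_const (!₂[1, 0] : EuclideanSpace ℂ (Fin 2))).const_add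
        (!₂[Complex.I * ((1 - 2 * t : ℝ) : ℂ), ((ψ x : ℝ) : ℂ)] : EuclideanSpace ℂ (Fin 2))
      have e1 : ∀ ζ, (!₂[Complex.I * ((1 - 2 * t : ℝ) : ℂ), ((ψ x : ℝ) : ℂ)] +
          h ζ • !₂[1, 0] : EuclideanSpace ℂ (Fin 2)) =
          !₂[Complex.I * ((1 - 2 * t : ℝ) : ℂ) + h ζ, ((ψ x : ℝ) : ℂ)] := by
        intro ζ
        ext i
        fin_cases i <;> simp
      have e2 : (h' • !₂[1, 0] : EuclideanSpace ℂ (Fin 2)) = !₂[h', 0] := by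
        ext i
        fin_cases i <;> simp
      simp only [e1, e2] at h1
      exact h1
    refine (kobayashiRoyden_le (α := α) ?_ (hdisc t ht) (by simp [h0]) ?_).trans hαle
    · rw [differentiableOn_euclidean]
      intro i
      fin_cases i
      · simpa using hd.const_add (Complex.I * ((1 - 2 * t : ℝ) : ℂ))
      · simp
    · rw [hφ'.deriv]
      ext i
      fin_cases i
      · simp [hα]
        ring
      · simp

end IsModelDomain

/-! ### Comparison of the estimates and conclusion. -/

theorem eventually_add_le_neg_log {ψ : ℝ → ℝ} (hψ : IsProfile ψ)
    (hψo : ψ =o[𝓝[>] (0 : ℝ)] fun x : ℝ => Real.exp (-(Real.pi / (2 * x)))) (M : ℝ) :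
    ∀ᶠ x : ℝ in 𝓝[>] 0, Real.pi / (2 * x) + M ≤ -Real.log (ψ x) := by
  filter_upwards [hψo.bound (Real.exp_pos (-M)), self_mem_nhdsWithin] with x hx hx0
  have hpos := hψ.pos hx0
  rw [Real.norm_of_nonneg hpos.le, Real.norm_of_nonneg (Real.exp_pos _).le, ← Real.exp_add,
    ← Real.log_le_iff_le_exp hpos] at hx
  linarith

theorem mainTheorem9 (ψ χ₁ χ₂ : ℝ → ℝ) (hψ : IsProfile ψ) (hχ₁ : IsProfile χ₁)
    (hχ₂ : IsProfile χ₂) (Ω : Set (EuclideanSpace ℂ (Fin 2))) (hΩ : IsModelDomain ψ χ₁ χ₂ Ω)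
    (hψo : ψ =o[𝓝[>] (0 : ℝ)] fun x : ℝ => Real.exp (-(Real.pi / (2 * x)))) :
    (∀ o ∈ Ω,
      limsup
        (fun w : EuclideanSpace ℂ (Fin 2) × EuclideanSpace ℂ (Fin 2) =>
          ((gromovProduct Ω o w.1 w.2 : ℝ) : EReal))
        (𝓝[Ω ×ˢ Ω] ((!₂[Complex.I, 0] : EuclideanSpace ℂ (Fin 2)),
          (!₂[-Complex.I, 0] : EuclideanSpace ℂ (Fin 2)))) = ⊤) ∧
    ¬ HasVisibilityProperty Ω := by
  set P : ℝ → EuclideanSpace ℂ (Fin 2) := fun x => !₂[Complex.I, ((ψ x : ℝ) : ℂ)] with hP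
  set Q : ℝ → EuclideanSpace ℂ (Fin 2) := fun x => !₂[-Complex.I, ((ψ x : ℝ) : ℂ)] with hQ
  have hPlim : Tendsto P (𝓝[>] 0) (𝓝 !₂[Complex.I, 0]) := IsModelDomain.tendsto_vertical hψ _
  have hQlim : Tendsto Q (𝓝[>] 0) (𝓝 !₂[-Complex.I, 0]) := IsModelDomain.tendsto_vertical hψ _
  have hmem : ∀ᶠ x : ℝ in 𝓝[>] 0, 0 < x ∧ P x ∈ Ω ∧ Q x ∈ Ω ∧
      kobayashiDist Ω (P x) (Q x) ≤ Real.pi / (2 * x) + 2 := by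
    filter_upwards [hΩ.eventually_mem hψ hχ₁ hχ₂] with x hx
    exact ⟨hx.1, hx.2 _ (by simpa using hx.1) (by simp), hx.2 _ (by simpa using hx.1) (by simp),
      hΩ.kobayashiDist_vertical_le hx.1 hx.2⟩
  have hlow : ∀ {c x : ℝ} {z w : EuclideanSpace ℂ (Fin 2)}, 0 < c → 0 < x → z ∈ Ω → w ∈ Ω →
      c ≤ (z 1).re → (w 1).re = ψ x →
      (Real.log c - Real.log (ψ x)) / 2 ≤ kobayashiDist Ω w z := by
    intro c x z w hc hx hz hw hcz hwx
    have h1 := hΩ.log_div_le hψ hχ₁ hχ₂ hz hw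
    rw [hwx, Real.log_div (hc.trans_le hcz).ne' (hψ.pos hx).ne',
      kobayashiDist_comm hΩ.isOpen] at h1
    have h2 := Real.log_le_log hc hcz
    linarith
  have hP1 : ∀ x, ((P x) 1).re = ψ x := fun x => by simp [hP]
  have hQ1 : ∀ x, ((Q x) 1).re = ψ x := fun x => by simp [hQ]
  constructor
  · intro o ho
    have ho1 := hΩ.re_pos hψ hχ₁ hχ₂ ho
    rw [EReal.eq_top_iff_forall_lt]
    intro M
    refine (EReal.coe_lt_coe_iff.2 (lt_add_one M)).trans_le (le_limsup_of_frequently_le' ?_)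
    have hlim : Tendsto (fun x => (P x, Q x)) (𝓝[>] 0)
        (𝓝[Ω ×ˢ Ω] ((!₂[Complex.I, 0] : EuclideanSpace ℂ (Fin 2)),
          (!₂[-Complex.I, 0] : EuclideanSpace ℂ (Fin 2)))) :=
      tendsto_nhdsWithin_iff.2 ⟨hPlim.prodMk_nhds hQlim, hmem.mono fun x hx => ⟨hx.2.1, hx.2.2.1⟩⟩
    refine hlim.frequently (Eventually.frequently ?_)
    -- The constant makes twice the Gromov product at least (2M + 4) - 2 = 2(M + 1).
    filter_upwards [hmem, eventually_add_le_neg_log hψ hψo (2 * M + 4 - Real.log (o 1).re)]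
      with x ⟨hx, hPx, hQx, hPQ⟩ hlog
    have h1 := hlow ho1 hx ho hPx le_rfl (hP1 x)
    have h2 := hlow ho1 hx ho hQx le_rfl (hQ1 x)
    rw [kobayashiDist_comm hΩ.isOpen] at h2
    rw [EReal.coe_le_coe_iff, gromovProduct]
    linarith
  · intro hvis
    have hfr : ∀ {R : ℝ → EuclideanSpace ℂ (Fin 2)} {z : ℂ},
        Tendsto R (𝓝[>] 0) (𝓝 !₂[z, 0]) → (∀ᶠ x in 𝓝[>] 0, R x ∈ Ω) →
        (!₂[z, 0] : EuclideanSpace ℂ (Fin 2)) ∈ frontier Ω := by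
      intro R z hR hRΩ
      refine ⟨mem_closure_of_tendsto hR hRΩ, fun h => ?_⟩
      have := hΩ.re_pos hψ hχ₁ hχ₂ (interior_subset h)
      simp at this
    obtain ⟨U, hU, V, hV, -, K, hK, hKΩ, hgeo⟩ := hvis _
      (hfr hPlim (hmem.mono fun x hx => hx.2.1)) _ (hfr hQlim (hmem.mono fun x hx => hx.2.2.1))
      (fun h => by
        have := congrArg (fun z : EuclideanSpace ℂ (Fin 2) => (z 0).im) h
        norm_num at this)
    -- Compactness gives a uniform positive lower bound for Re z₂ on `K`.
    obtain ⟨c, hc, hcK⟩ := hK.exists_forall_le' (f := fun z => (z 1).re) (a := 0)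
      (Continuous.continuousOn (by fun_prop)) fun z hz => hΩ.re_pos hψ hχ₁ hχ₂ (hKΩ hz)
    -- With the constant 3, passing through `K` costs at least π/(2x) + 3, more than the upper bound
    -- π/(2x) + 2.
    obtain ⟨x, ⟨hx, hPx, hQx, hPQ⟩, hlog, hxU, hxV⟩ := (hmem.and
      ((eventually_add_le_neg_log hψ hψo (3 - Real.log c)).and
        ((hPlim.eventually hU).and (hQlim.eventually hV)))).exists
    obtain ⟨σ, hσ, hσ0, hσL⟩ := exists_isKobayashiGeodesic hΩ.isOpen hΩ.convex
      (Metric.isBounded_ball.subset hΩ.subset_ball) hPx hQx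
    obtain ⟨_, ⟨s, hs, rfl⟩, hsK⟩ := hgeo _ σ kobayashiDist_nonneg hσ (hσ0 ▸ hxU) (by rwa [hσL])
    have hL : (0 : ℝ) ≤ kobayashiDist Ω (P x) (Q x) := kobayashiDist_nonneg
    have e1 := hσ.2.2 0 (left_mem_Icc.2 hL) s hs
    have e2 := hσ.2.2 _ (right_mem_Icc.2 hL) s hs
    rw [hσ0, zero_sub, abs_neg, abs_of_nonneg hs.1] at e1
    rw [hσL, abs_of_nonneg (sub_nonneg.2 hs.2)] at e2
    have h1 := hlow hc hx (hKΩ hsK) hPx (hcK _ hsK) (hP1 x)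
    have h2 := hlow hc hx (hKΩ hsK) hQx (hcK _ hsK) (hQ1 x)
    linarith
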